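/- Let $n\ge 1$ be an integer, let $\gamma,\delta>0$ and $p_{11n}\in(0,1)$, and set $$q_{1n}=1-(1+\gamma)p_{11n},\qquad q_{2n}=1-(1+\delta)p_{11n},\qquad p_{00n}=1-(1+\gamma+\delta)p_{11n},$$ where $p_{00n}>0$. Let $\mathbf X_1,\dots,\mathbf X_n$ be i.i.d. random pairs in $\mathbb Z_+^2$ with the Marshall–Olkin geometric distribution with parameters $q_{1n},q_{2n},p_{00n}$, i.e. (omitting the subscript $n$ of the parameters) $$P(\mathbf X_i=(k,l))=\begin{cases}p_{00}^k\,q_2^{\,l-k}\,(1-p_{00}/q_2-q_2+p_{00}), & k<l,\\ p_{00}^k\,(1-q_1-q_2+p_{00}), & k=l,\\ p_{00}^l\,q_1^{\,k-l}\,(1-q_1-p_{00}/q_1+p_{00}), & k>l.\end{cases}$$ Let $\mathbf X_i^\star=\log(1/p_{00n})\,\mathbf X_i-(\log n,\log n)$, let $u_n^\star\ge-\log n$, $A^\star=[u_n^\star,\infty)^2$, and let $\Xi^\star_{A^\star}=\sum_{i=1}^n I_{\{\mathbf X_i^\star\in A^\star\}}\,\delta_{\mathbf X_i^\star}$ be the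 marked point process of joint exceedances of $u_n^\star$. Let $\boldsymbol\lambda^\star_{\gamma,\delta}$ be the measure on $A^\star$ given by $$\boldsymbol\lambda^\star_{\gamma,\delta}(B)=\iint_{B}\lambda^\star_{\gamma,\delta}(s,t)\,ds\,dt+\int_{\{s:\,(s,s)\in B\}}\frac{e^{-s}}{1+\gamma+\delta}\,ds,$$ $$\lambda^\star_{\gamma,\delta}(s,t)=\begin{cases}\dfrac{\gamma(1+\delta)}{(1+\gamma+\delta)^2}\,e^{-\frac{\gamma}{1+\gamma+\delta}s}\,e^{-\frac{1+\delta}{1+\gamma+\delta}t}, & s<t,\\[2ex] \dfrac{\delta(1+\gamma)}{(1+\gamma+\delta)^2}\,e^{-\frac{1+\gamma}{1+\gamma+\delta}s}\,e^{-\frac{\delta}{1+\gamma+\delta}t}, & s>t,\end{cases}$$ and let $\mathrm{PRM}(\boldsymbol\lambda^\star_{\gamma,\delta})$ be the law of the Poisson process on $A^\star$ with mean measure $\boldsymbol\lambda^\star_{\gamma,\delta}$. Then $$d_2\bigl(\mathcal L(\Xi^\star_{A^\star}),\mathrm{PRM}(\boldsymbol\lambda^\star_{\gamma,\delta})\bigr)\le\frac{e^{-u_n^\star}}{n}+\frac{(1+\gamma+\delta)^2p_{11n}}{[1-(1+\gamma+\delta)p_{11n}]^3}\Bigl\{2\sqrt2+7\bigl(e^{-u_n^\star}\wedge1.65\,e^{-u_n^\star/2}\bigr)\Bigr\}.$$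 Here $d_0(z,w)=\min(|z-w|,1)$ with the Euclidean norm; for finite point measures $\xi,\eta$ on $A^\star$, $d_1(\xi,\eta)=1$ if $\xi(A^\star)\ne\eta(A^\star)$, and otherwise $d_1(\xi,\eta)=\xi(A^\star)^{-1}\sup_\kappa|\int\kappa\,d\xi-\int\kappa\,d\eta|$ over all $\kappa:A^\star\to\mathbb R$ with $|\kappa(z)-\kappa(w)|\le d_0(z,w)$ (and $d_1(0,0)=0$); and $d_2(\mu,\nu)=\sup_h|\int h\,d\mu-\int h\,d\nu|$ over all measurable real functions $h$ on the space of finite point measures on $A^\star$ with $|h(\xi)-h(\eta)|\le d_1(\xi,\eta)$. -/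

import Mathlib

open MeasureTheory ProbabilityTheory
open scoped ENNReal Nat

namespace PointProcess

section General

variable {E : Type*} [MeasurableSpace E]

/-- A finite point measure: a finite sum of Dirac measures at not necessarily distinct points. -/
def IsPointMeasure (ξ : Measure E) : Prop :=
  ∃ (m : ℕ) (z : Fin m → E), ξ = ∑ i, Measure.dirac (z i)

/-- The space `M_p(E)` of finite point measures on `E`. -/
def PointMeasure (E : Type*) [MeasurableSpace E] : Type _ :=
  {ξ : Measure E // IsPointMeasure ξ}

/-- The smallest `σ`-algebra on `M_p(E)` that makes all evaluations `ξ ↦ ξ B`, for measurable `B`,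
measurable (this is how Mathlib's `σ`-algebra on `Measure E` is defined). -/
instance : MeasurableSpace (PointMeasure E) :=
  inferInstanceAs (MeasurableSpace {ξ : Measure E // IsPointMeasure ξ})

/-- The point configuration `∑ δ_{z i}`. -/
noncomputable def config {m : ℕ} (z : Fin m → E) : PointMeasure E :=
  ⟨∑ i, Measure.dirac (z i), m, z, rfl⟩

lemma measurable_eval {B : Set E} (hB : MeasurableSet B) :
    Measurable fun ξ : PointMeasure E ↦ ξ.1 B :=
  (Measure.measurable_coe hB).comp measurable_subtype_coe

lemma measurable_config (m : ℕ) : Measurable (config : (Fin m → E) → PointMeasure E) := by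
  refine Measurable.subtype_mk (Measure.measurable_of_measurable_coe _ fun s hs ↦ ?_)
  simp only [Measure.finsetSum_apply]
  exact Finset.measurable_sum _ fun i _ ↦
    (Measure.measurable_coe hs).comp (Measure.measurable_dirac.comp (measurable_pi_apply i))

lemma isPointMeasure_zero : IsPointMeasure (0 : Measure E) :=
  ⟨0, Fin.elim0, by simp⟩

lemma isPointMeasure_dirac (z : E) : IsPointMeasure (Measure.dirac z) :=
  ⟨1, fun _ ↦ z, by simp⟩

lemma IsPointMeasure.add {ξ η : Measure E} (hξ : IsPointMeasure ξ) (hη : IsPointMeasure η) :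
    IsPointMeasure (ξ + η) := by
  obtain ⟨m, z, rfl⟩ := hξ
  obtain ⟨k, w, rfl⟩ := hη
  exact ⟨m + k, Fin.append z w, by simp [Fin.sum_univ_add]⟩

lemma isPointMeasure_sum {ι : Type*} (s : Finset ι) {ξ : ι → Measure E}
    (h : ∀ i ∈ s, IsPointMeasure (ξ i)) : IsPointMeasure (∑ i ∈ s, ξ i) :=
  Finset.sum_induction ξ IsPointMeasure (fun _ _ ↦ IsPointMeasure.add) isPointMeasure_zero h

open Classical in
/-- The part in `A` of the configuration of the points `x 1, …, x n`, as a point measure on `A`: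
`∑ i, I_{x i ∈ A} δ_{x i}`. -/
noncomputable def configIn {n : ℕ} (A : Set E) (x : Fin n → E) : PointMeasure A :=
  ⟨∑ i, if h : x i ∈ A then Measure.dirac (⟨x i, h⟩ : A) else 0, isPointMeasure_sum _ fun i _ ↦ by
    by_cases h : x i ∈ A
    · simpa [h] using isPointMeasure_dirac _
    · simpa [h] using isPointMeasure_zero⟩

/-- `Q` is the law of a Poisson process with finite mean measure `lam`: the number of points in
`B` is Poisson distributed with mean `lam B`, and the numbers of points in mutually disjoint sets
are independent. -/
structure IsPoissonLaw (lam : Measure E) (Q : Measure (PointMeasure E)) : Prop where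
  isProbabilityMeasure : IsProbabilityMeasure Q
  map_eval : ∀ B : Set E, MeasurableSet B →
    Q.map (fun ξ ↦ ξ.1 B) = (poissonMeasure (lam B).toNNReal).map (Nat.cast : ℕ → ℝ≥0∞)
  indep : ∀ (m : ℕ) (B : Fin m → Set E), (∀ i, MeasurableSet (B i)) →
    Pairwise (fun i j ↦ Disjoint (B i) (B j)) → iIndepFun (fun i (ξ : PointMeasure E) ↦ ξ.1 (B i)) Q

/-- `PRM(lam)`, the law of the Poisson process with finite mean measure `lam`:
`PRM(lam)(R) = e^{-lam(E)} ∑_k (1/k!) ∫_{E^k} I_{δ_{z_1} + ⋯ + δ_{z_k} ∈ R} lam(dz_1) ⋯ lam(dz_k)`.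
The theorem `isPoissonLaw_PRM` below shows that it has the properties that define that law. -/
noncomputable def PRM (lam : Measure E) : Measure (PointMeasure E) :=
  Measure.sum fun k : ℕ ↦ ENNReal.ofReal (Real.exp (-lam.real Set.univ) / k !) •
    (Measure.pi fun _ : Fin k ↦ lam).map config

lemma measure_lt_top (ξ : PointMeasure E) (B : Set E) : ξ.1 B < ∞ := by
  obtain ⟨ξ, m, z, rfl⟩ := ξ
  exact MeasureTheory.measure_lt_top _ B

lemma isProbabilityMeasure_PRM (lam : Measure E) [IsFiniteMeasure lam] :
    IsProbabilityMeasure (PRM lam) := by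
  constructor
  set r := (lam Set.univ).toNNReal with hr
  have hru : lam Set.univ = (r : ℝ≥0∞) := (ENNReal.coe_toNNReal (measure_ne_top _ _)).symm
  have hrr : lam.real Set.univ = (r : ℝ) := by simp [measureReal_def, hru]
  have h1 : ∀ k : ℕ, (ENNReal.ofReal (Real.exp (-lam.real Set.univ) / k !) •
      (Measure.pi fun _ : Fin k ↦ lam).map config : Measure (PointMeasure E)) Set.univ =
      ENNReal.ofReal (Real.exp (-r) * r ^ k / k !) := by
    intro k
    rw [Measure.smul_apply, Measure.map_apply (measurable_config k) MeasurableSet.univ,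
      Set.preimage_univ, Measure.pi_univ, hrr]
    simp only [hru, Finset.prod_const, Finset.card_univ, Fintype.card_fin, smul_eq_mul]
    rw [← ENNReal.ofReal_coe_nnreal, ← ENNReal.ofReal_pow (NNReal.coe_nonneg r),
      ← ENNReal.ofReal_mul (by positivity)]
    congr 1
    ring
  rw [PRM, Measure.sum_apply _ MeasurableSet.univ]
  simp_rw [h1]
  rw [← ENNReal.ofReal_tsum_of_nonneg (fun k ↦ by positivity)
    (hasSum_one_poissonMeasure r).summable, (hasSum_one_poissonMeasure r).tsum_eq,
    ENNReal.ofReal_one]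

open Complex in
/-- The joint characteristic function of the numbers of points in disjoint sets. -/
lemma integral_cexp_PRM (lam : Measure E) [IsFiniteMeasure lam] {m : ℕ} (B : Fin m → Set E)
    (hB : ∀ i, MeasurableSet (B i)) (hd : Pairwise (fun i j ↦ Disjoint (B i) (B j)))
    (t : Fin m → ℝ) :
    ∫ ξ : PointMeasure E, cexp (((∑ i, (ξ.1 (B i)).toReal * t i : ℝ) : ℂ) * I) ∂(PRM lam) =
      ∏ i, cexp (lam.real (B i) * (cexp (t i * I) - 1)) := by
  classical
  have := isProbabilityMeasure_PRM lam
  have hmeas : Measurable fun ξ : PointMeasure E ↦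
      cexp (((∑ i, (ξ.1 (B i)).toReal * t i : ℝ) : ℂ) * I) := by
    have : Measurable fun ξ : PointMeasure E ↦ (∑ i, (ξ.1 (B i)).toReal * t i : ℝ) :=
      Finset.measurable_sum _ fun i _ ↦ ((measurable_eval (hB i)).ennreal_toReal).mul_const _
    fun_prop
  have hint : Integrable (fun ξ : PointMeasure E ↦
      cexp (((∑ i, (ξ.1 (B i)).toReal * t i : ℝ) : ℂ) * I)) (PRM lam) :=
    Integrable.of_bound hmeas.aestronglyMeasurable 1
      (Filter.Eventually.of_forall fun ξ ↦ (norm_exp_ofReal_mul_I _).le)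
  set g : E → ℂ := fun z ↦ cexp (((∑ i, (B i).indicator (fun _ ↦ (1 : ℝ)) z * t i : ℝ) : ℂ) * I)
    with hg
  have hterm : ∀ k : ℕ, ∫ ξ : PointMeasure E, cexp (((∑ i, (ξ.1 (B i)).toReal * t i : ℝ) : ℂ) * I)
      ∂(ENNReal.ofReal (Real.exp (-lam.real Set.univ) / k !) •
      (Measure.pi fun _ : Fin k ↦ lam).map config) =
      cexp (-(lam.real Set.univ : ℂ)) * ((∫ z, g z ∂lam) ^ k / k !) := by
    intro k
    rw [integral_smul_measure, integral_map (measurable_config k).aemeasurable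
      hmeas.aestronglyMeasurable, ENNReal.toReal_ofReal (by positivity)]
    have : ∀ z : Fin k → E, cexp (((∑ i, ((config z).1 (B i)).toReal * t i : ℝ) : ℂ) * I) =
        ∏ j, g (z j) := by
      intro z
      rw [hg, ← Complex.exp_sum, ← Finset.sum_mul, ← ofReal_sum, Finset.sum_comm]
      congr 3
      refine Finset.sum_congr rfl fun i _ ↦ ?_
      rw [← Finset.sum_mul]
      congr 1
      simp only [config, Measure.finsetSum_apply]
      rw [ENNReal.toReal_sum (fun j _ ↦ (MeasureTheory.measure_lt_top (Measure.dirac (z j)) (B i)).ne)]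
      refine Finset.sum_congr rfl fun j _ ↦ ?_
      rw [Measure.dirac_apply' _ (hB i)]
      by_cases h : z j ∈ B i <;> simp [h]
    simp_rw [this]
    rw [integral_fintype_prod_eq_pow]
    simp only [Fintype.card_fin, real_smul]
    push_cast
    ring
  have hgi : ∫ z, g z ∂lam = lam.real Set.univ + ∑ i, lam.real (B i) * (cexp (t i * I) - 1) := by
    have hgz : ∀ z, g z = 1 + ∑ i, (B i).indicator (fun _ ↦ cexp (t i * I) - 1) z := by
      intro z
      by_cases h : ∃ i, z ∈ B i
      · obtain ⟨i, hi⟩ := h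
        have hne : ∀ j, j ≠ i → z ∉ B j := fun j hj hz ↦
          Set.disjoint_left.1 (hd hj) hz hi
        rw [Finset.sum_eq_single i (fun j _ hj ↦ by simp [hne j hj]) (by simp)]
        simp only [hg]
        rw [Finset.sum_eq_single i (fun j _ hj ↦ by simp [hne j hj]) (by simp)]
        simp [hi]
      · push Not at h
        simp [hg, h]
    simp_rw [hgz]
    rw [integral_add (integrable_const _) (integrable_finsetSum _ fun i _ ↦
      (integrable_const _).indicator (hB i)), integral_finsetSum _ fun i _ ↦
      (integrable_const _).indicator (hB i)]
    simp [integral_indicator_const, hB]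
  have hsum := hasSum_integral_measure (f := fun ξ : PointMeasure E ↦
      cexp (((∑ i, (ξ.1 (B i)).toReal * t i : ℝ) : ℂ) * I)) (μ := fun k : ℕ ↦
      ENNReal.ofReal (Real.exp (-lam.real Set.univ) / k !) •
      (Measure.pi fun _ : Fin k ↦ lam).map config) hint
  simp_rw [hterm] at hsum
  have hexp := (NormedSpace.expSeries_div_hasSum_exp (∫ z, g z ∂lam)).mul_left
    (cexp (-(lam.real Set.univ : ℂ)))
  rw [PRM, hsum.unique hexp, ← Complex.exp_eq_exp_ℂ, ← Complex.exp_add, hgi, ← Complex.exp_sum]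
  congr 1
  ring

open Complex in
theorem isPoissonLaw_PRM (lam : Measure E) [IsFiniteMeasure lam] :
    IsPoissonLaw lam (PRM lam) := by
  have hP := isProbabilityMeasure_PRM lam
  have hmr : ∀ B : Set E, MeasurableSet B →
      Measurable fun ξ : PointMeasure E ↦ (ξ.1 B).toReal := fun B hB ↦
    (measurable_eval hB).ennreal_toReal
  have hback : ∀ (B : Set E) (ξ : PointMeasure E), ENNReal.ofReal (ξ.1 B).toReal = ξ.1 B :=
    fun B ξ ↦ ENNReal.ofReal_toReal (measure_lt_top ξ B).ne
  have hchar : ∀ (B : Set E), MeasurableSet B → ∀ t : ℝ,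
      charFun ((PRM lam).map fun ξ ↦ (ξ.1 B).toReal) t =
        cexp (lam.real B * (cexp (t * I) - 1)) := by
    intro B hB t
    rw [charFun_apply, integral_map (hmr B hB).aemeasurable (by fun_prop)]
    have := integral_cexp_PRM lam (fun _ : Fin 1 ↦ B) (fun _ ↦ hB)
      (fun i j hij ↦ absurd (Subsingleton.elim i j) hij) (fun _ ↦ t)
    simp only [Finset.univ_unique, Finset.sum_singleton, Finset.prod_singleton] at this
    rw [← this]
    simp [mul_comm]
  refine ⟨hP, fun B hB ↦ ?_, fun m B hB hd ↦ ?_⟩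
  · have h1 : (PRM lam).map (fun ξ ↦ (ξ.1 B).toReal) =
        (poissonMeasure (lam B).toNNReal).map (Nat.cast : ℕ → ℝ) := by
      have := Measure.isProbabilityMeasure_map (μ := PRM lam) (hmr B hB).aemeasurable
      apply Measure.ext_of_charFun
      ext t
      rw [hchar B hB t, charFun_map_cast_poissonMeasure]
      rfl
    have h2 := congrArg (Measure.map ENNReal.ofReal) h1
    rw [Measure.map_map ENNReal.measurable_ofReal (hmr B hB),
      Measure.map_map ENNReal.measurable_ofReal .of_discrete] at h2
    have h3 : (ENNReal.ofReal ∘ fun ξ : PointMeasure E ↦ (ξ.1 B).toReal) = fun ξ ↦ ξ.1 B :=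
      funext fun ξ ↦ hback B ξ
    have h4 : (ENNReal.ofReal ∘ (Nat.cast : ℕ → ℝ)) = (Nat.cast : ℕ → ℝ≥0∞) :=
      funext fun k ↦ ENNReal.ofReal_natCast k
    rwa [h3, h4] at h2
  · have h1 : iIndepFun (fun i (ξ : PointMeasure E) ↦ (ξ.1 (B i)).toReal) (PRM lam) := by
      rw [iIndepFun_iff_charFun_pi (fun i ↦ (hmr _ (hB i)).aemeasurable)]
      intro t
      have hm : Measurable fun ξ : PointMeasure E ↦
          WithLp.toLp 2 (fun i ↦ (ξ.1 (B i)).toReal) := by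
        have : Measurable fun ξ : PointMeasure E ↦ fun i ↦ (ξ.1 (B i)).toReal :=
          measurable_pi_lambda _ fun i ↦ hmr _ (hB i)
        exact (WithLp.measurable_toLp 2 (Fin m → ℝ)).comp this
      simp_rw [fun i ↦ hchar (B i) (hB i)]
      rw [← integral_cexp_PRM lam B hB hd, charFun_apply,
        integral_map hm.aemeasurable (by fun_prop)]
      simp [PiLp.inner_apply, mul_comm]
    have h2 := h1.comp (fun _ ↦ ENNReal.ofReal) (fun _ ↦ ENNReal.measurable_ofReal)
    have h3 : (fun i ↦ ENNReal.ofReal ∘ fun ξ : PointMeasure E ↦ (ξ.1 (B i)).toReal) =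
        fun i (ξ : PointMeasure E) ↦ ξ.1 (B i) := by
      funext i ξ
      exact hback (B i) ξ
    rwa [h3] at h2

end General

/-- For measures of equal finite mass, functions of oscillation at most `1` have integrals that
differ at most by that mass. -/
lemma abs_integral_sub_le {X : Type*} [MeasurableSpace X] (μ ν : Measure X) [IsFiniteMeasure μ]
    [IsFiniteMeasure ν] (h : μ Set.univ = ν Set.univ) {f : X → ℝ} (hf : Measurable f)
    (hosc : ∀ x y, |f x - f y| ≤ 1) :
    |∫ x, f x ∂μ - ∫ x, f x ∂ν| ≤ μ.real Set.univ := by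
  rcases isEmpty_or_nonempty X with hX | hX
  · simp [Measure.eq_zero_of_isEmpty]
  have hbdd : BddBelow (Set.range f) := by
    obtain ⟨x₀⟩ := hX
    refine ⟨f x₀ - 1, ?_⟩
    rintro _ ⟨x, rfl⟩
    have := abs_le.1 (hosc x₀ x)
    linarith
  set a := ⨅ x, f x with ha
  have h0 : ∀ x, 0 ≤ f x - a := fun x ↦ sub_nonneg.2 (ciInf_le hbdd x)
  have h1 : ∀ x, f x - a ≤ 1 := fun x ↦ by
    have : f x - 1 ≤ a := le_ciInf fun y ↦ by
      have := abs_le.1 (hosc x y)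
      linarith
    linarith
  have hreal : μ.real Set.univ = ν.real Set.univ := by simp [measureReal_def, h]
  have key : ∀ (ρ : Measure X) [IsFiniteMeasure ρ],
      ∫ x, f x ∂ρ = ∫ x, (f x - a) ∂ρ + a * ρ.real Set.univ ∧
      0 ≤ ∫ x, (f x - a) ∂ρ ∧ ∫ x, (f x - a) ∂ρ ≤ ρ.real Set.univ := by
    intro ρ _
    have hi : Integrable (fun x ↦ f x - a) ρ :=
      Integrable.of_bound (hf.sub_const a).aestronglyMeasurable 1
        (Filter.Eventually.of_forall fun x ↦ by
          rw [Real.norm_eq_abs, abs_of_nonneg (h0 x)]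
          exact h1 x)
    refine ⟨?_, integral_nonneg h0, ?_⟩
    · have := integral_add hi (integrable_const a)
      simp only [sub_add_cancel, integral_const, smul_eq_mul] at this
      rw [this, mul_comm]
    · simpa using integral_mono hi (integrable_const (1 : ℝ)) h1
  obtain ⟨e1, p1, q1⟩ := key μ
  obtain ⟨e2, p2, q2⟩ := key ν
  rw [e1, e2, hreal, abs_le]
  rw [hreal] at q1
  constructor <;> linarith

section Distances

variable {E : Type*} [PseudoMetricSpace E] [MeasurableSpace E]

/-- The metric of `E`, bounded by `1`. -/
noncomputable def d0 (x y : E) : ℝ := min (dist x y) 1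

/-- The distance `d_1` between finite measures: `1` if the total masses differ, and otherwise the
supremum of `|∫ κ dρ - ∫ κ dσ|` over the functions `κ` with Lipschitz constant at most `1` with
respect to `d_0`, divided by the common total mass (and `0` if this mass is `0`). -/
noncomputable def d1 (ρ σ : Measure E) : ℝ :=
  if ρ Set.univ = σ Set.univ then
    (ρ.real Set.univ)⁻¹ *
      ⨆ κ : {κ : E → ℝ // ∀ x y, |κ x - κ y| ≤ d0 x y}, |∫ z, κ.1 z ∂ρ - ∫ z, κ.1 z ∂σ|
  else 1

/-- The distance `d_2` between probability measures on `M_p(E)`: the supremum of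
`|∫ h dμ - ∫ h dν|` over the functions `h` on `M_p(E)` with Lipschitz constant at most `1` with
respect to `d_1`. (When `E` is a separable metric space with its Borel `σ`-algebra, such functions
are measurable anyway; in general the integrals only make sense for measurable `h`.) -/
noncomputable def d2 (μ ν : Measure (PointMeasure E)) : ℝ :=
  ⨆ h : {h : PointMeasure E → ℝ // Measurable h ∧ ∀ ξ η, |h ξ - h η| ≤ d1 ξ.1 η.1},
    |∫ ξ, h.1 ξ ∂μ - ∫ ξ, h.1 ξ ∂ν|

lemma abs_integral_sub_le_of_lipschitz [OpensMeasurableSpace E] (ρ σ : Measure E)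
    [IsFiniteMeasure ρ] [IsFiniteMeasure σ] (h : ρ Set.univ = σ Set.univ) {κ : E → ℝ}
    (hκ : ∀ x y, |κ x - κ y| ≤ d0 x y) :
    |∫ z, κ z ∂ρ - ∫ z, κ z ∂σ| ≤ ρ.real Set.univ := by
  have hL : LipschitzWith 1 κ := LipschitzWith.of_dist_le_mul fun x y ↦ by
    rw [Real.dist_eq]
    simpa using (hκ x y).trans (min_le_left _ _)
  exact abs_integral_sub_le ρ σ h hL.continuous.measurable
    fun x y ↦ (hκ x y).trans (min_le_right _ _)

/-- The set of which `d1` takes the supremum is bounded. -/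
lemma bddAbove_d1 [OpensMeasurableSpace E] (ρ σ : Measure E)
    [IsFiniteMeasure ρ] [IsFiniteMeasure σ] (h : ρ Set.univ = σ Set.univ) :
    BddAbove (Set.range fun κ : {κ : E → ℝ // ∀ x y, |κ x - κ y| ≤ d0 x y} ↦
      |∫ z, κ.1 z ∂ρ - ∫ z, κ.1 z ∂σ|) := by
  refine ⟨ρ.real Set.univ, ?_⟩
  rintro _ ⟨κ, rfl⟩
  exact abs_integral_sub_le_of_lipschitz ρ σ h κ.2

lemma d1_le_one [OpensMeasurableSpace E] (ρ σ : Measure E)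
    [IsFiniteMeasure ρ] [IsFiniteMeasure σ] : d1 ρ σ ≤ 1 := by
  unfold d1
  split_ifs with h
  · refine (mul_le_mul_of_nonneg_left (Real.iSup_le (fun κ ↦
      abs_integral_sub_le_of_lipschitz ρ σ h κ.2) measureReal_nonneg)
      (inv_nonneg.2 measureReal_nonneg)).trans ?_
    exact inv_mul_le_one
  · exact le_rfl

/-- The set of which `d2` takes the supremum is bounded. -/
lemma bddAbove_d2 [OpensMeasurableSpace E] (μ ν : Measure (PointMeasure E))
    [IsProbabilityMeasure μ] [IsProbabilityMeasure ν] :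
    BddAbove (Set.range fun h : {h : PointMeasure E → ℝ //
        Measurable h ∧ ∀ ξ η, |h ξ - h η| ≤ d1 ξ.1 η.1} ↦
      |∫ ξ, h.1 ξ ∂μ - ∫ ξ, h.1 ξ ∂ν|) := by
  refine ⟨μ.real Set.univ, ?_⟩
  rintro _ ⟨h, rfl⟩
  refine abs_integral_sub_le μ ν (by simp) h.2.1 fun ξ η ↦ (h.2.2 ξ η).trans ?_
  have : IsFiniteMeasure ξ.1 := ⟨measure_lt_top ξ _⟩
  have : IsFiniteMeasure η.1 := ⟨measure_lt_top η _⟩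
  exact d1_le_one _ _

end Distances

end PointProcess

namespace MarshallOlkin

/-- The point probabilities of the Marshall-Olkin geometric distribution on `ℤ₊²` with marginal
failure probabilities `q₁`, `q₂` and joint failure probability `p₀₀`. -/
noncomputable def geometricPMF (q₁ q₂ p₀₀ : ℝ) (x : ℕ × ℕ) : ℝ :=
  if x.1 < x.2 then p₀₀ ^ x.1 * q₂ ^ (x.2 - x.1) * (1 - p₀₀ / q₂ - q₂ + p₀₀)
  else if x.1 = x.2 then p₀₀ ^ x.1 * (1 - q₁ - q₂ + p₀₀)
  else p₀₀ ^ x.2 * q₁ ^ (x.1 - x.2) * (1 - q₁ - p₀₀ / q₁ + p₀₀)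

/-- The Marshall-Olkin geometric distribution. -/
noncomputable def geometricLaw (q₁ q₂ p₀₀ : ℝ) : Measure (ℕ × ℕ) :=
  Measure.sum fun x ↦ ENNReal.ofReal (geometricPMF q₁ q₂ p₀₀ x) • Measure.dirac x

/-- The plane, with the Euclidean norm. -/
abbrev Plane : Type := EuclideanSpace ℝ (Fin 2)

/-- The normalisation `(k, l) ↦ (k log(1/p₀₀) - log n, l log(1/p₀₀) - log n)`. -/
noncomputable def normalise (n : ℕ) (p₀₀ : ℝ) (x : ℕ × ℕ) : Plane :=
  !₂[x.1 * Real.log (1 / p₀₀) - Real.log n, x.2 * Real.log (1 / p₀₀) - Real.log n]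

/-- The set `[u, ∞)²`. -/
def quadrant (u : ℝ) : Set Plane := {z | u ≤ z 0 ∧ u ≤ z 1}

/-- The marked point process `∑ i, I_{X*_i ∈ A} δ_{X*_i}` of the joint exceedances of `u`, where
`X*_i` are the normalised marks and `A = [u, ∞)²`; it is a random point measure on `A`. -/
noncomputable def exceedanceProcess {Ω : Type*} (n : ℕ) (p₀₀ u : ℝ) (X : Fin n → Ω → ℕ × ℕ)
    (ω : Ω) : PointProcess.PointMeasure (quadrant u) :=
  PointProcess.configIn (quadrant u) fun i ↦ normalise n p₀₀ (X i ω)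

/-- The off-diagonal part `λ*_{γ,δ}(s, t)` of the limiting intensity. -/
noncomputable def offDiagonalIntensity (γ δ : ℝ) (z : Plane) : ℝ :=
  if z 0 < z 1 then
    γ * (1 + δ) / (1 + γ + δ) ^ 2 *
      Real.exp (-(γ / (1 + γ + δ)) * z 0) * Real.exp (-((1 + δ) / (1 + γ + δ)) * z 1)
  else if z 1 < z 0 then
    δ * (1 + γ) / (1 + γ + δ) ^ 2 *
      Real.exp (-((1 + γ) / (1 + γ + δ)) * z 0) * Real.exp (-(δ / (1 + γ + δ)) * z 1)
  else 0

/-- The intensity on the diagonal `s = t`, parametrised by its projection to the `s`-axis. -/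
noncomputable def diagonalIntensity (γ δ s : ℝ) : ℝ :=
  1 / (1 + γ + δ) * Real.exp (-s)

/-- The measure on the plane with density `offDiagonalIntensity` with respect to two-dimensional
Lebesgue measure off the diagonal, and density `diagonalIntensity` with respect to
one-dimensional Lebesgue measure `ds` on the diagonal. -/
noncomputable def intensityMeasure (γ δ : ℝ) : Measure Plane :=
  (volume.withDensity fun z : Plane ↦ ENNReal.ofReal (offDiagonalIntensity γ δ z)) +
    (volume.withDensity fun s : ℝ ↦ ENNReal.ofReal (diagonalIntensity γ δ s)).map
      fun s ↦ (!₂[s, s] : Plane)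

/-- The restriction of `intensityMeasure γ δ` to `[u, ∞)²`, as a measure on `[u, ∞)²`. -/
noncomputable def limitMeanMeasure (γ δ u : ℝ) : Measure (quadrant u) :=
  (intensityMeasure γ δ).comap Subtype.val

end MarshallOlkin

/-! Write M = 1 + γ + δ, x = M p₁₁, b = e^{-u} and r = log(1/p₀₀). In terms of the smaller
coordinate s and the excess y of the larger one, the limiting intensity is a product: e^{-s} ds,
times a mixture of an exponential excess of the second coordinate (weight γ/M, rate (1+δ)/M), an
exponential excess of the first (weight δ/M, rate (1+γ)/M) and no excess (weight 1/M). The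
Marshall-Olkin geometric law has the same structure with geometric variables in place of exponential
ones. Since rounding turns exponential variables into geometric ones, an explicit map f of the
quadrant carries the normalised limit measure ν exactly to the law of a normalised mark conditioned
to lie in the quadrant (`smul_map_latticePoint`). The probability of lying there is p₀₀^k, where k
is the first lattice index inside the quadrant.

The exceedance process thus has a Bin(n, p₀₀^k) number of i.i.d. points with law `ν.map f`
(`integral_configIn`), and the Poisson process has a Poisson number, with mean b, of i.i.d. points
with law ν (`integral_PRM`). Three replacements lead from one to the other
(`d2_map_configIn_PRM_le`): the binomial count by a Poisson count with the same mean, at cost p₀₀^k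
≤ b/n by the Stein-Chen method (`abs_binomialMean_sub_poissonMean_le`); the Poisson mean n p₀₀^k by
b, where the error is bounded both by the difference of the means and by that of their square roots;
each rounded point by the original point, at cost min(b, 1) times the mean displacement under f,
because d₁ averages over the points and an empty configuration needs no change.

The displacement is at most 3r plus x/(1-x) times the excess, the latter because the lattice spacing
r differs slightly from the spacings that make the excesses geometric. Elementary bounds on
logarithms then give the constants (`sum_bounds_le`), with room to spare. -/

namespace PoissonApprox

/-! ### Binomial expectations. -/

/-- The expectation of `F` under the binomial distribution with parameters `n` and `p`, by recursion
on the number of trials. -/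
def binomialMean (p : ℝ) : ℕ → (ℕ → ℝ) → ℝ
  | 0, F => F 0
  | n + 1, F => (1 - p) * binomialMean p n F + p * binomialMean p n fun k ↦ F (k + 1)

lemma binomialMean_const (p c : ℝ) (n : ℕ) : binomialMean p n (fun _ ↦ c) = c := by
  induction n with
  | zero => rfl
  | succ n ih => rw [binomialMean, ih]; ring

lemma binomialMean_add (p : ℝ) (n : ℕ) (F G : ℕ → ℝ) :
    binomialMean p n (fun k ↦ F k + G k) = binomialMean p n F + binomialMean p n G := by
  induction n generalizing F G with
  | zero => rfl
  | succ n ih =>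
    simp only [binomialMean, ih]
    ring

lemma binomialMean_mul (p c : ℝ) (n : ℕ) (F : ℕ → ℝ) :
    binomialMean p n (fun k ↦ c * F k) = c * binomialMean p n F := by
  induction n generalizing F with
  | zero => rfl
  | succ n ih =>
    simp only [binomialMean, ih]
    ring

lemma binomialMean_sub (p : ℝ) (n : ℕ) (F G : ℕ → ℝ) :
    binomialMean p n (fun k ↦ F k - G k) = binomialMean p n F - binomialMean p n G := by
  have := binomialMean_add p n F (fun k ↦ -1 * G k)
  rw [binomialMean_mul] at this
  simpa [sub_eq_add_neg] using this

lemma binomialMean_mono {p : ℝ} (h0 : 0 ≤ p) (h1 : p ≤ 1) (n : ℕ) {F G : ℕ → ℝ}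
    (h : ∀ k, F k ≤ G k) : binomialMean p n F ≤ binomialMean p n G := by
  induction n generalizing F G with
  | zero => exact h 0
  | succ n ih =>
    exact add_le_add (mul_le_mul_of_nonneg_left (ih h) (by linarith))
      (mul_le_mul_of_nonneg_left (ih fun k ↦ h (k + 1)) h0)

lemma abs_binomialMean_le {p : ℝ} (h0 : 0 ≤ p) (h1 : p ≤ 1) (n : ℕ) {F : ℕ → ℝ} {c : ℝ}
    (h : ∀ k, |F k| ≤ c) : |binomialMean p n F| ≤ c := by
  rw [abs_le]
  constructor
  · rw [← binomialMean_const p (-c) n]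
    exact binomialMean_mono h0 h1 n fun k ↦ (abs_le.1 (h k)).1
  · rw [← binomialMean_const p c n]
    exact binomialMean_mono h0 h1 n fun k ↦ (abs_le.1 (h k)).2

/-- The size-bias identity `E[N g(N)] = n p E[g(N' + 1)]`. -/
lemma binomialMean_natCast_mul (p : ℝ) (n : ℕ) (g : ℕ → ℝ) :
    binomialMean p (n + 1) (fun k ↦ k * g k) =
      (n + 1) * p * binomialMean p n fun k ↦ g (k + 1) := by
  induction n generalizing g with
  | zero => simp [binomialMean]
  | succ n ih =>
    rw [binomialMean, ih]
    have h1 : (fun k : ℕ ↦ ((k + 1 : ℕ) : ℝ) * g (k + 1)) =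
        fun k : ℕ ↦ k * g (k + 1) + g (k + 1) := by
      funext k; push_cast; ring
    rw [h1, binomialMean_add, ih fun k ↦ g (k + 1)]
    simp only [binomialMean]
    push_cast
    ring

/-! ### Poisson expectations. -/

/-- The Poisson point probabilities. -/
noncomputable def poissonWeight (l : ℝ) (k : ℕ) : ℝ := Real.exp (-l) * l ^ k / k !

/-- The expectation of `H` under the Poisson distribution with mean `l`. -/
noncomputable def poissonMean (l : ℝ) (H : ℕ → ℝ) : ℝ := ∑' k, poissonWeight l k * H k

lemma poissonWeight_nonneg {l : ℝ} (hl : 0 ≤ l) (k : ℕ) : 0 ≤ poissonWeight l k := by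
  unfold poissonWeight; positivity

lemma poissonWeight_pos {l : ℝ} (hl : 0 < l) (k : ℕ) : 0 < poissonWeight l k := by
  unfold poissonWeight; positivity

lemma hasSum_poissonWeight {l : ℝ} (hl : 0 ≤ l) : HasSum (poissonWeight l) 1 :=
  hasSum_one_poissonMeasure ⟨l, hl⟩

lemma mul_poissonWeight (l : ℝ) (k : ℕ) :
    l * poissonWeight l k = (k + 1) * poissonWeight l (k + 1) := by
  unfold poissonWeight
  rw [Nat.factorial_succ]
  push_cast
  have : (k : ℝ) + 1 ≠ 0 := by positivity
  field_simp
  ring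

lemma summable_poissonWeight_mul {l : ℝ} (hl : 0 ≤ l) {H : ℕ → ℝ} {c : ℝ} (hH : ∀ k, |H k| ≤ c) :
    Summable fun k ↦ poissonWeight l k * H k := by
  refine Summable.of_norm_bounded ((hasSum_poissonWeight hl).summable.mul_right c) fun k ↦ ?_
  rw [Real.norm_eq_abs, abs_mul, abs_of_nonneg (poissonWeight_nonneg hl k)]
  exact mul_le_mul_of_nonneg_left (hH k) (poissonWeight_nonneg hl k)

lemma poissonMean_one_sub {l : ℝ} (hl : 0 ≤ l) {H : ℕ → ℝ} {c : ℝ} (hH : ∀ k, |H k| ≤ c) :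
    poissonMean l (fun k ↦ 1 - H k) = 1 - poissonMean l H := by
  unfold poissonMean
  simp_rw [mul_sub, mul_one]
  rw [(hasSum_poissonWeight hl).summable.tsum_sub (summable_poissonWeight_mul hl hH),
    (hasSum_poissonWeight hl).tsum_eq]

/-! ### The Stein equation of the Poisson distribution and the Barbour-Hall bound. -/

section Stein

/-- `P(N < k) (E[H(N) | N < k] - E[H(N)])` for a Poisson variable `N` with mean `l`. -/
noncomputable def steinSum (l : ℝ) (H : ℕ → ℝ) (k : ℕ) : ℝ :=
  ∑ j ∈ Finset.range k, poissonWeight l j * (H j - poissonMean l H)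

/-- The solution of the Stein equation of the Poisson distribution with mean `l`. -/
noncomputable def steinSolution (l : ℝ) (H : ℕ → ℝ) (k : ℕ) : ℝ :=
  steinSum l H k / (k * poissonWeight l k)

/-- By the recursion `mul_poissonWeight`, both terms on the left have the denominator `poissonWeight
l k`, so their difference is the last summand of `steinSum l H (k + 1)` divided by it. -/
lemma steinSolution_eq {l : ℝ} (hl : 0 < l) (H : ℕ → ℝ) (k : ℕ) :
    l * steinSolution l H (k + 1) - k * steinSolution l H k = H k - poissonMean l H := by
  have hw := (poissonWeight_pos hl k).ne'
  have h1 : l * steinSolution l H (k + 1) = steinSum l H (k + 1) / poissonWeight l k := by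
    unfold steinSolution
    push_cast
    rw [← mul_poissonWeight]
    field_simp
  have h2 : k * steinSolution l H k = steinSum l H k / poissonWeight l k := by
    -- For `k = 0` the solution is `0 / 0`, which is harmless: the factor `k` and the empty sum both
    -- vanish.
    rcases eq_or_ne k 0 with rfl | hk
    · simp [steinSum]
    · have : (k : ℝ) ≠ 0 := by exact_mod_cast hk
      unfold steinSolution
      field_simp
  rw [h1, h2, ← sub_div, steinSum, Finset.sum_range_succ, ← steinSum]
  field_simp
  ring

lemma steinSolution_one_sub {l : ℝ} (hl : 0 ≤ l) {H : ℕ → ℝ} {c : ℝ} (hH : ∀ k, |H k| ≤ c)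
    (k : ℕ) : steinSolution l (fun k ↦ 1 - H k) k = -steinSolution l H k := by
  unfold steinSolution steinSum
  rw [poissonMean_one_sub hl hH, ← neg_div, ← Finset.sum_neg_distrib]
  congr 1
  exact Finset.sum_congr rfl fun j _ ↦ by ring

/-- The increment is linear in `H`. With `m = k + 1`, the values of `H` below and above `m` enter it
with nonpositive coefficients, so for `0 ≤ H ≤ 1` only `H m` can make it positive, and the
coefficient of `H m` is at most `1 / l`. The signs come from comparing consecutive lower sums `A`
and tails `R` of the Poisson weights. -/
lemma steinSolution_sub_le {l : ℝ} (hl : 0 < l) {H : ℕ → ℝ} (h0 : ∀ k, 0 ≤ H k)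
    (h1 : ∀ k, H k ≤ 1) (k : ℕ) :
    steinSolution l H (k + 2) - steinSolution l H (k + 1) ≤ 1 / l := by
  set w := poissonWeight l with hw
  have wpos : ∀ k, 0 < w k := poissonWeight_pos hl
  have sw : Summable w := (hasSum_poissonWeight hl.le).summable
  have hHabs : ∀ k, |H k| ≤ 1 := fun k ↦ by rw [abs_of_nonneg (h0 k)]; exact h1 k
  have sH : Summable fun k ↦ w k * H k := summable_poissonWeight_mul hl.le hHabs
  set A : ℕ → ℝ := fun k ↦ ∑ j ∈ Finset.range k, w j with hA
  set R : ℕ → ℝ := fun k ↦ ∑' j, w (j + k) with hR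
  set S : ℕ → ℝ := fun k ↦ ∑ j ∈ Finset.range k, w j * H j with hS
  set T : ℕ → ℝ := fun k ↦ ∑' j, w (j + k) * H (j + k) with hT
  have hAR : ∀ k, A k + R k = 1 := fun k ↦ by
    rw [hA, hR]
    exact (sw.sum_add_tsum_nat_add k).trans (hasSum_poissonWeight hl.le).tsum_eq
  have hST : ∀ k, S k + T k = poissonMean l H := fun k ↦ sH.sum_add_tsum_nat_add k
  -- This form separates the values of `H` below `k`, collected in `S`, from the others, collected
  -- in `T`.
  have hD : ∀ k, steinSum l H k = S k * R k - A k * T k := fun k ↦ by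
    have : steinSum l H k = S k - poissonMean l H * A k := by
      simp only [steinSum, hS, hA, mul_sub, Finset.sum_sub_distrib, Finset.mul_sum]
      congr 1
      exact Finset.sum_congr rfl fun j _ ↦ mul_comm _ _
    rw [this, ← hST k]
    linear_combination -S k * hAR k
  have hA' : ∀ k : ℕ, l * A k ≤ k * A (k + 1) := fun k ↦ by
    calc l * A k = ∑ j ∈ Finset.range k, ((j : ℝ) + 1) * w (j + 1) := by
          rw [hA, Finset.mul_sum]
          exact Finset.sum_congr rfl fun j _ ↦ mul_poissonWeight l j
      _ ≤ ∑ j ∈ Finset.range k, (k : ℝ) * w (j + 1) := by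
          refine Finset.sum_le_sum fun j hj ↦ mul_le_mul_of_nonneg_right ?_ (wpos _).le
          exact_mod_cast Finset.mem_range.1 hj
      _ = k * (A (k + 1) - w 0) := by
          rw [← Finset.mul_sum, hA]
          simp only [Finset.sum_range_succ' w k]
          ring
      _ ≤ _ := mul_le_mul_of_nonneg_left (by linarith [wpos 0]) (Nat.cast_nonneg k)
  have hR' : ∀ k : ℕ, (k : ℝ) * R (k + 1) ≤ l * R k := fun k ↦ by
    rw [hR]
    simp only [← tsum_mul_left]
    refine Summable.tsum_le_tsum (fun j ↦ ?_) (((summable_nat_add_iff (k + 1)).2 sw).mul_left _)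
      (((summable_nat_add_iff k).2 sw).mul_left _)
    rw [hw, mul_poissonWeight, ← add_assoc]
    refine mul_le_mul_of_nonneg_right ?_ (poissonWeight_nonneg hl.le _)
    push_cast
    linarith [(Nat.cast_nonneg j : (0 : ℝ) ≤ j)]
  have S0 : ∀ k, 0 ≤ S k := fun k ↦ Finset.sum_nonneg fun j _ ↦ mul_nonneg (wpos j).le (h0 j)
  have T0 : ∀ k, 0 ≤ T k := fun k ↦ tsum_nonneg fun j ↦ mul_nonneg (wpos _).le (h0 _)
  have Ssucc : ∀ k, S (k + 1) = S k + w k * H k := fun k ↦ Finset.sum_range_succ _ k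
  have Tsucc : ∀ k, T k = T (k + 1) + w k * H k := fun k ↦ by
    linarith [hST k, hST (k + 1), Ssucc k]
  set m := k + 1
  have hm : (0 : ℝ) < m := by positivity
  have e1 : steinSolution l H (k + 2) = steinSum l H (m + 1) / (l * w m) := by
    change steinSum l H (m + 1) / (((m + 1 : ℕ) : ℝ) * poissonWeight l (m + 1)) = _
    rw [hw, mul_poissonWeight, Nat.cast_succ]
  have e2 : steinSolution l H (k + 1) = steinSum l H m / (m * w m) := rfl
  rw [e1, e2, hD, hD, Ssucc, Tsucc m]
  -- `p1` and `p2` discard the contributions of `S m` and `T (m + 1)`; `p3` and `A + R = 1` bound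
  -- the coefficient of the atom at `m`.
  have p1 := mul_nonneg (S0 m) (sub_nonneg.2 (hR' m))
  have p2 := mul_nonneg (T0 (m + 1)) (sub_nonneg.2 (hA' m))
  have p3 := mul_nonneg (mul_nonneg (wpos m).le (h0 m)) (sub_nonneg.2 (hA' m))
  have p4 : w m * H m ≤ w m := mul_le_of_le_one_right (wpos m).le (h1 m)
  have hwm := wpos m
  rw [div_sub_div _ _ (by positivity) (by positivity), div_le_div_iff₀ (by positivity) hl]
  have hAR1 : R (m + 1) = 1 - A (m + 1) := by linarith [hAR (m + 1)]
  have key : m * ((S m + w m * H m) * R (m + 1) - A (m + 1) * T (m + 1)) -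
      l * (S m * R m - A m * (T (m + 1) + w m * H m)) ≤ m * w m := by
    have : m * (w m * H m) * R (m + 1) + l * A m * (w m * H m) ≤ m * (w m * H m) := by
      rw [hAR1]; linarith
    have := mul_le_mul_of_nonneg_left p4 hm.le
    linarith
  have := mul_le_mul_of_nonneg_right key (by positivity : 0 ≤ l * w m)
  linarith

/-- Replacing `H` by `1 - H` changes the sign of the solution, so the one-sided bound gives both
sides. -/
lemma abs_steinSolution_sub_le {l : ℝ} (hl : 0 < l) {H : ℕ → ℝ} (h0 : ∀ k, 0 ≤ H k)
    (h1 : ∀ k, H k ≤ 1) (k : ℕ) :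
    |steinSolution l H (k + 2) - steinSolution l H (k + 1)| ≤ 1 / l := by
  have hH : ∀ k, |H k| ≤ 1 := fun k ↦ by rw [abs_of_nonneg (h0 k)]; exact h1 k
  have h := steinSolution_sub_le hl (H := fun k ↦ 1 - H k) (fun k ↦ by linarith [h1 k])
    (fun k ↦ by linarith [h0 k]) k
  rw [steinSolution_one_sub hl.le hH, steinSolution_one_sub hl.le hH] at h
  rw [abs_le]
  constructor
  · linarith
  · exact steinSolution_sub_le hl h0 h1 k

end Stein

/-- The Barbour-Hall bound for the Poisson approximation of the binomial distribution. -/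
theorem abs_binomialMean_sub_poissonMean_le {p : ℝ} (hp0 : 0 < p) (hp1 : p ≤ 1) {n : ℕ}
    (hn : 1 ≤ n) {H : ℕ → ℝ} (h0 : ∀ k, 0 ≤ H k) (h1 : ∀ k, H k ≤ 1) :
    |binomialMean p n H - poissonMean (n * p) H| ≤ p := by
  obtain ⟨m, rfl⟩ : ∃ m, n = m + 1 := ⟨n - 1, by omega⟩
  set l : ℝ := ((m + 1 : ℕ) : ℝ) * p with hl_def
  have hl : 0 < l := by positivity
  set g := steinSolution l H
  -- Taking the binomial mean of the Stein equation gives `l (E g(N + 1) - E g(N' + 1))` by size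
  -- biasing, where `N'` counts one trial fewer. Conditioning `N` on the extra trial leaves `p`
  -- times an increment of `g`.
  have e : binomialMean p (m + 1) H - poissonMean l H =
      l * p * binomialMean p m fun k ↦ g (k + 2) - g (k + 1) := by
    rw [← binomialMean_const p (poissonMean l H) (m + 1), ← binomialMean_sub]
    simp_rw [← steinSolution_eq hl H]
    rw [binomialMean_sub, binomialMean_natCast_mul, binomialMean_mul, binomialMean_sub,
      binomialMean]
    have hlm : ((m : ℝ) + 1) * p = l := by push_cast [hl_def]; rfl
    rw [hlm]
    ring
  rw [e, abs_mul, abs_of_pos (by positivity)]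
  have := abs_binomialMean_le hp0.le hp1 m (abs_steinSolution_sub_le hl h0 h1)
  calc l * p * _ ≤ l * p * (1 / l) := mul_le_mul_of_nonneg_left this (by positivity)
    _ = p := by field_simp

/-! ### Comparison of Poisson distributions with different means. -/

lemma poissonMean_sub_le {a b : ℝ} (ha : 0 ≤ a) (hab : a ≤ b) {H : ℕ → ℝ} (h0 : ∀ k, 0 ≤ H k)
    (h1 : ∀ k, H k ≤ 1) : poissonMean a H - poissonMean b H ≤ b - a := by
  have hH : ∀ k, |H k| ≤ 1 := fun k ↦ by rw [abs_of_nonneg (h0 k)]; exact h1 k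
  have hb := ha.trans hab
  have he : 1 - (b - a) ≤ Real.exp (-(b - a)) := by linarith [Real.add_one_le_exp (-(b - a))]
  -- A Poisson variable with mean `b` is the sum of independent ones with means `a` and `b - a`; the
  -- event that the second is zero accounts for this share of the weights.
  have hw : ∀ k, (1 - (b - a)) * poissonWeight a k ≤ poissonWeight b k := fun k ↦ by
    refine (mul_le_mul_of_nonneg_right he (poissonWeight_nonneg ha k)).trans ?_
    have : Real.exp (-(b - a)) * poissonWeight a k = Real.exp (-b) * a ^ k / k ! := by
      rw [poissonWeight, ← mul_div_assoc, ← mul_assoc, ← Real.exp_add]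
      ring_nf
    rw [this, poissonWeight]
    gcongr
  have hs := summable_poissonWeight_mul ha hH
  have hle : (1 - (b - a)) * poissonMean a H ≤ poissonMean b H := by
    unfold poissonMean
    rw [← tsum_mul_left]
    refine Summable.tsum_le_tsum (fun k ↦ ?_) (hs.mul_left _) (summable_poissonWeight_mul hb hH)
    rw [← mul_assoc]
    exact mul_le_mul_of_nonneg_right (hw k) (h0 k)
  have h1' : poissonMean a H ≤ 1 := by
    rw [← (hasSum_poissonWeight ha).tsum_eq]
    exact Summable.tsum_le_tsum (fun k ↦ mul_le_of_le_one_right (poissonWeight_nonneg ha k) (h1 k))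
      hs (hasSum_poissonWeight ha).summable
  nlinarith [mul_le_mul_of_nonneg_left h1' (sub_nonneg.2 hab)]

theorem abs_poissonMean_sub_le {a b : ℝ} (ha : 0 ≤ a) (hab : a ≤ b) {H : ℕ → ℝ}
    (h0 : ∀ k, 0 ≤ H k) (h1 : ∀ k, H k ≤ 1) : |poissonMean a H - poissonMean b H| ≤ b - a := by
  have hH : ∀ k, |H k| ≤ 1 := fun k ↦ by rw [abs_of_nonneg (h0 k)]; exact h1 k
  have h := poissonMean_sub_le ha hab (H := fun k ↦ 1 - H k) (fun k ↦ by linarith [h1 k])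
    (fun k ↦ by linarith [h0 k])
  rw [poissonMean_one_sub ha hH, poissonMean_one_sub (ha.trans hab) hH] at h
  rw [abs_le]
  constructor
  · linarith
  · exact poissonMean_sub_le ha hab h0 h1

/-- The Hellinger affinity of two Poisson distributions. -/
lemma hasSum_sqrt_poissonWeight_mul {a b : ℝ} (ha : 0 ≤ a) (hb : 0 ≤ b) :
    HasSum (fun k ↦ √(poissonWeight a k) * √(poissonWeight b k))
      (Real.exp (-(√b - √a) ^ 2 / 2)) := by
  have h := (NormedSpace.expSeries_div_hasSum_exp (𝔸 := ℝ) (√a * √b)).mul_left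
    (Real.exp (-(a + b) / 2))
  rw [← Real.exp_eq_exp_ℝ, ← Real.exp_add] at h
  have he : -(√b - √a) ^ 2 / 2 = -(a + b) / 2 + √a * √b := by
    nlinarith [Real.mul_self_sqrt ha, Real.mul_self_sqrt hb]
  have hf : (fun k ↦ √(poissonWeight a k) * √(poissonWeight b k)) =
      fun k : ℕ ↦ Real.exp (-(a + b) / 2) * ((√a * √b) ^ k / k !) := by
    funext k
    rw [← Real.sqrt_mul (poissonWeight_nonneg ha k),
      Real.sqrt_eq_iff_mul_self_eq (mul_nonneg (poissonWeight_nonneg ha k)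
        (poissonWeight_nonneg hb k)) (by positivity)]
    have e1 : (√a * √b) ^ k * (√a * √b) ^ k = a ^ k * b ^ k := by
      rw [← mul_pow, ← mul_pow]
      congr 1
      nlinarith [Real.mul_self_sqrt ha, Real.mul_self_sqrt hb]
    have e2 : Real.exp (-(a + b) / 2) * Real.exp (-(a + b) / 2) =
        Real.exp (-a) * Real.exp (-b) := by
      rw [← Real.exp_add, ← Real.exp_add]
      congr 1
      ring
    unfold poissonWeight
    calc _ = Real.exp (-a) * Real.exp (-b) * (a ^ k * b ^ k) / (k ! * k !) := by ring
      _ = _ := by rw [← e1, ← e2]; ring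
  rw [he, hf]
  exact h

/-- This is the Hellinger bound on total variation. Factor the difference of the weights as a
difference of squares of their roots, and apply the inequality of arithmetic and geometric means
with balance parameter `x = √b - √a`. The affinity then yields `x / 2` from each of the two
resulting sums. -/
theorem abs_poissonMean_sub_le_sqrt {a b : ℝ} (ha : 0 ≤ a) (hab : a ≤ b) {H : ℕ → ℝ}
    (h0 : ∀ k, 0 ≤ H k) (h1 : ∀ k, H k ≤ 1) :
    |poissonMean a H - poissonMean b H| ≤ √b - √a := by
  rcases hab.eq_or_lt with rfl | hlt
  · simp
  have hb := ha.trans hab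
  have hH : ∀ k, |H k| ≤ 1 := fun k ↦ by rw [abs_of_nonneg (h0 k)]; exact h1 k
  set x := √b - √a with hx
  have hx0 : 0 < x := sub_pos.2 (Real.sqrt_lt_sqrt ha hlt)
  set v := poissonWeight a
  set w := poissonWeight b
  have v0 : ∀ k, 0 ≤ v k := poissonWeight_nonneg ha
  have w0 : ∀ k, 0 ≤ w k := poissonWeight_nonneg hb
  have hv : HasSum v 1 := hasSum_poissonWeight ha
  have hw : HasSum w 1 := hasSum_poissonWeight hb
  have hvw := hasSum_sqrt_poissonWeight_mul ha hb
  have hsum := (((hv.add hw).sub (hvw.mul_left 2)).mul_left (1 / (2 * x))).add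
    ((hv.add hw).mul_left (x / 4))
  have hterm : ∀ k, |(v k - w k) * (H k - 1 / 2)| ≤
      1 / (2 * x) * (v k + w k - 2 * (√(v k) * √(w k))) + x / 4 * (v k + w k) := fun k ↦ by
    -- Centring `H` at `1 / 2`, which is free since both families of weights sum to `1`, gains the
    -- factor `1 / 2`.
    have hh : |H k - 1 / 2| ≤ 1 / 2 := by
      rw [abs_le]; constructor <;> linarith [h0 k, h1 k]
    have e : |v k - w k| = |√(v k) - √(w k)| * (√(v k) + √(w k)) := by
      rw [← abs_of_nonneg (by positivity : 0 ≤ √(v k) + √(w k)), ← abs_mul]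
      congr 1
      nlinarith [Real.mul_self_sqrt (v0 k), Real.mul_self_sqrt (w0 k)]
    set s := √(v k)
    set t := √(w k)
    have hs : v k = s ^ 2 := (Real.sq_sqrt (v0 k)).symm
    have ht : w k = t ^ 2 := (Real.sq_sqrt (w0 k)).symm
    rw [abs_mul]
    refine (mul_le_mul_of_nonneg_left hh (abs_nonneg _)).trans ?_
    rw [e, hs, ht]
    have q : (|s - t| / x - (s + t) / 2) ^ 2 * x ≥ 0 := by positivity
    have q1 : (|s - t| / x - (s + t) / 2) ^ 2 * x =
        (s - t) ^ 2 / x - |s - t| * (s + t) + (s + t) ^ 2 / 4 * x := by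
      rw [← sq_abs (s - t)]; field_simp; ring
    have q2 : 0 ≤ (s - t) ^ 2 * x := by positivity
    have q3 : 1 / (2 * x) * (s ^ 2 + t ^ 2 - 2 * (s * t)) = ((s - t) ^ 2 / x) / 2 := by
      field_simp; ring
    rw [q3]
    nlinarith
  have e : poissonMean a H - poissonMean b H = ∑' k, (v k - w k) * (H k - 1 / 2) := by
    have s1 := (summable_poissonWeight_mul ha hH).hasSum.sub (hv.mul_right (1 / 2))
    have s2 := (summable_poissonWeight_mul hb hH).hasSum.sub (hw.mul_right (1 / 2))
    have := (s1.sub s2).tsum_eq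
    unfold poissonMean
    rw [sub_sub_sub_cancel_right] at this
    rw [← this]
    exact tsum_congr fun k ↦ by ring
  rw [e]
  have hb1 := tsum_of_norm_bounded hsum (f := fun k ↦ (v k - w k) * (H k - 1 / 2)) hterm
  rw [Real.norm_eq_abs] at hb1
  refine hb1.trans ?_
  have hexp : 1 - x ^ 2 / 2 ≤ Real.exp (-x ^ 2 / 2) := by
    linarith [Real.add_one_le_exp (-x ^ 2 / 2)]
  have : 1 / (2 * x) * (1 + 1 - 2 * Real.exp (-x ^ 2 / 2)) ≤ 1 / (2 * x) * x ^ 2 :=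
    mul_le_mul_of_nonneg_left (by linarith) (by positivity)
  have e2 : 1 / (2 * x) * x ^ 2 = x / 2 := by field_simp
  linarith

end PoissonApprox

namespace PointProcess

open PoissonApprox

/-! ### Binomial and Poisson processes as mixtures over the number of points. -/

section Mixture

variable {E : Type*} [MeasurableSpace E]

lemma integrable_of_abs_le {X : Type*} [MeasurableSpace X] (μ : Measure X) [IsFiniteMeasure μ]
    {f : X → ℝ} (hf : Measurable f) {c : ℝ} (hc : ∀ x, |f x| ≤ c) : Integrable f μ :=
  Integrable.of_bound hf.aestronglyMeasurable c (Filter.Eventually.of_forall hc)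

lemma abs_integral_le_of_abs_le {X : Type*} [MeasurableSpace X] (μ : Measure X)
    [IsProbabilityMeasure μ] {f : X → ℝ} {c : ℝ} (hc : ∀ x, |f x| ≤ c) : |∫ x, f x ∂μ| ≤ c := by
  have h : ∀ x, ‖f x‖ ≤ c := hc
  simpa using norm_integral_le_of_norm_le_const (μ := μ) (Filter.Eventually.of_forall h)

lemma integral_binomialMean {X : Type*} [MeasurableSpace X] (μ : Measure X) (p : ℝ) (n : ℕ)
    {F : X → ℕ → ℝ} (hF : ∀ k, Integrable (fun x ↦ F x k) μ) :
    Integrable (fun x ↦ binomialMean p n (F x)) μ ∧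
      ∫ x, binomialMean p n (F x) ∂μ = binomialMean p n fun k ↦ ∫ x, F x k ∂μ := by
  induction n generalizing F with
  | zero => exact ⟨hF 0, rfl⟩
  | succ n ih =>
    obtain ⟨i1, e1⟩ := ih hF
    obtain ⟨i2, e2⟩ := ih fun k ↦ hF (k + 1)
    simp only [binomialMean]
    refine ⟨(i1.const_mul _).add (i2.const_mul _), ?_⟩
    rw [integral_add (i1.const_mul _) (i2.const_mul _), integral_const_mul, integral_const_mul,
      e1, e2]

lemma measurable_finCons (n : ℕ) :
    Measurable fun q : E × (Fin n → E) ↦ (Fin.cons q.1 q.2 : Fin (n + 1) → E) := by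
  refine measurable_pi_lambda _ fun i ↦ ?_
  refine Fin.cases ?_ (fun j ↦ ?_) i
  · exact measurable_fst
  · exact (measurable_pi_apply j).comp measurable_snd

lemma integral_pi_succ (μ : Measure E) [IsProbabilityMeasure μ] (n : ℕ)
    {F : (Fin (n + 1) → E) → ℝ} (hF : Measurable F) {c : ℝ} (hc : ∀ x, |F x| ≤ c) :
    ∫ x, F x ∂(Measure.pi fun _ : Fin (n + 1) ↦ μ) =
      ∫ a, ∫ x, F (Fin.cons a x) ∂(Measure.pi fun _ : Fin n ↦ μ) ∂μ := by
  have h := (measurePreserving_piFinSuccAbove (fun _ : Fin (n + 1) ↦ μ) 0).symm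
  rw [← h.integral_comp']
  have hi : Integrable (fun q : E × (Fin n → E) ↦ F (Fin.cons q.1 q.2))
      (μ.prod (Measure.pi fun _ : Fin n ↦ μ)) :=
    integrable_of_abs_le _ (hF.comp (measurable_finCons n)) fun q ↦ hc _
  have e : ∀ q, (MeasurableEquiv.piFinSuccAbove (fun _ : Fin (n + 1) ↦ E) 0).symm q =
      Fin.cons q.1 q.2 := fun q ↦ by
    simp [MeasurableEquiv.piFinSuccAbove_symm_apply, Fin.insertNthEquiv]
  simp_rw [e]
  exact integral_prod _ hi

/-- The point measure with one more point. -/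
noncomputable def addPoint (a : E) (ξ : PointMeasure E) : PointMeasure E :=
  ⟨Measure.dirac a + ξ.1, (isPointMeasure_dirac a).add ξ.2⟩

lemma measurable_addPoint (a : E) : Measurable (addPoint a) := by
  refine Measurable.subtype_mk (Measure.measurable_of_measurable_coe _ fun s hs ↦ ?_)
  simp only [Measure.add_apply]
  exact measurable_const.add (measurable_eval hs)

lemma config_cons {n : ℕ} (a : E) (z : Fin n → E) :
    config (Fin.cons a z : Fin (n + 1) → E) = addPoint a (config z) := by
  apply Subtype.ext
  simp [config, addPoint, Fin.sum_univ_succ]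

lemma configIn_cons_of_mem {n : ℕ} {A : Set E} {a : E} (ha : a ∈ A) (x : Fin n → E) :
    configIn A (Fin.cons a x : Fin (n + 1) → E) = addPoint ⟨a, ha⟩ (configIn A x) := by
  apply Subtype.ext
  simp [configIn, addPoint, Fin.sum_univ_succ, ha]
  rfl

lemma configIn_cons_of_notMem {n : ℕ} {A : Set E} {a : E} (ha : a ∉ A) (x : Fin n → E) :
    configIn A (Fin.cons a x : Fin (n + 1) → E) = configIn A x := by
  apply Subtype.ext
  simp [configIn, Fin.sum_univ_succ, ha]
  rfl

lemma measurable_configIn {A : Set E} (hA : MeasurableSet A) (n : ℕ) :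
    Measurable (configIn A : (Fin n → E) → PointMeasure A) := by
  classical
  refine Measurable.subtype_mk (Measure.measurable_of_measurable_coe _ fun s hs ↦ ?_)
  simp only [Measure.finsetSum_apply]
  refine Finset.measurable_sum _ fun i _ ↦ ?_
  have : (fun x : Fin n → E ↦ (if h : x i ∈ A then Measure.dirac (⟨x i, h⟩ : A) else 0) s) =
      fun x ↦ ((Subtype.val '' s).indicator (fun _ ↦ (1 : ℝ≥0∞))) (x i) := by
    funext x
    by_cases h : x i ∈ A
    · by_cases h' : (⟨x i, h⟩ : A) ∈ s <;> simp [h, hs, h']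
    · simp [h]
  rw [this]
  exact (measurable_const.indicator (hA.subtype_image hs)).comp (measurable_pi_apply i)

/-- The points in `A` of an i.i.d. sample form a binomial number of i.i.d. points. -/
theorem integral_configIn {A : Set E} (hA : MeasurableSet A) (μ : Measure E)
    [IsProbabilityMeasure μ] (ν : Measure A) [IsProbabilityMeasure ν] {p : ℝ} (hp : 0 ≤ p)
    (hμν : μ.comap Subtype.val = ENNReal.ofReal p • ν) (n : ℕ) {h : PointMeasure A → ℝ}
    (hm : Measurable h) {c : ℝ} (hc : ∀ ξ, |h ξ| ≤ c) :
    ∫ x, h (configIn A x) ∂(Measure.pi fun _ : Fin n ↦ μ) =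
      binomialMean p n fun k ↦ ∫ z, h (config z) ∂(Measure.pi fun _ : Fin k ↦ ν) := by
  -- Since `ν` has mass `1`, the factor `p` is the probability that a sample point lies in `A`.
  have hμA : μ A = ENNReal.ofReal p := by
    have := congrArg (fun ρ : Measure A ↦ ρ Set.univ) hμν
    simpa [comap_subtype_coe_apply hA] using this
  have hAc : μ.real Aᶜ = 1 - p := by
    rw [probReal_compl_eq_one_sub hA, measureReal_def, hμA, ENNReal.toReal_ofReal hp]
  induction n generalizing h with
  | zero =>
    have e : ∀ x : Fin 0 → E, configIn A x = config (Fin.elim0 : Fin 0 → A) := fun x ↦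
      Subtype.ext (by simp [configIn, config])
    have e' : ∀ z : Fin 0 → A, z = Fin.elim0 := fun z ↦ Subsingleton.elim _ _
    simp only [e, binomialMean]
    rw [integral_const]
    conv_rhs => rw [show (fun z : Fin 0 → A ↦ h (config z)) = fun _ ↦ h (config Fin.elim0) from
      funext fun z ↦ by rw [e' z]]
    rw [integral_const]
    simp
  | succ n ih =>
    have hmA : Measurable fun x : Fin (n + 1) → E ↦ h (configIn A x) :=
      hm.comp (measurable_configIn hA _)
    rw [integral_pi_succ μ n hmA fun x ↦ hc _]
    set G : E → ℝ := fun a ↦ ∫ x, h (configIn A (Fin.cons a x)) ∂(Measure.pi fun _ : Fin n ↦ μ)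
    have hGm : Measurable G := by
      have : Measurable fun q : E × (Fin n → E) ↦ h (configIn A (Fin.cons q.1 q.2)) :=
        hmA.comp (measurable_finCons n)
      exact this.stronglyMeasurable.integral_prod_right.measurable
    have hGc : ∀ a, |G a| ≤ c := fun a ↦ abs_integral_le_of_abs_le _ fun x ↦ hc _
    -- Condition on the first sample point: outside `A` it leaves no trace, inside `A` it adds a
    -- point with law `ν`. These are the two terms of the recursion for `binomialMean`.
    rw [← integral_add_compl hA (integrable_of_abs_le μ hGm hGc), binomialMean, add_comm]
    congr 1
    · have : ∀ a ∈ Aᶜ, G a = ∫ x, h (configIn A x) ∂(Measure.pi fun _ : Fin n ↦ μ) := fun a ha ↦ by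
        simp only [G, configIn_cons_of_notMem ha]
      rw [setIntegral_congr_fun hA.compl this, setIntegral_const, hAc, ih hm hc, smul_eq_mul]
    · rw [← integral_subtype_comap hA, hμν, integral_smul_measure, ENNReal.toReal_ofReal hp,
        smul_eq_mul]
      congr 1
      have hadd : ∀ a : A, Measurable fun ξ ↦ h (addPoint a ξ) := fun a ↦
        hm.comp (measurable_addPoint a)
      -- The induction hypothesis is used for the functional `h ∘ addPoint a`, hence the induction
      -- over all `h`.
      have e : ∀ a : A, G a = binomialMean p n fun k ↦
          ∫ z, h (addPoint a (config z)) ∂(Measure.pi fun _ : Fin k ↦ ν) := fun a ↦ by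
        rw [← ih (hadd a) fun ξ ↦ hc _]
        simp only [G, configIn_cons_of_mem a.2]
      simp_rw [e]
      have hcm : ∀ k, Measurable fun z : Fin (k + 1) → A ↦ h (config z) := fun k ↦
        hm.comp (measurable_config _)
      rw [(integral_binomialMean ν p n fun k ↦ ?_).2]
      · congr 1
        funext k
        rw [integral_pi_succ ν k (hcm k) fun z ↦ hc _]
        simp_rw [config_cons]
      · refine integrable_of_abs_le ν ?_ (c := c) fun a ↦ abs_integral_le_of_abs_le _ fun z ↦ hc _
        have : Measurable fun q : A × (Fin k → A) ↦ h (config (Fin.cons q.1 q.2 : Fin (k + 1) → A)) :=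
          (hcm k).comp (measurable_finCons k)
        simp_rw [config_cons] at this
        exact this.stronglyMeasurable.integral_prod_right.measurable

lemma pi_smul_measure (ν : Measure E) [IsProbabilityMeasure ν] (b : ℝ) (k : ℕ) :
    (Measure.pi fun _ : Fin k ↦ ENNReal.ofReal b • ν) =
      ENNReal.ofReal b ^ k • Measure.pi fun _ : Fin k ↦ ν := by
  have : IsFiniteMeasure (ENNReal.ofReal b • ν) := Measure.smul_finite _ ENNReal.ofReal_ne_top
  refine Measure.pi_eq (μ := fun _ : Fin k ↦ ENNReal.ofReal b • ν) fun s _ ↦ ?_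
  simp [Measure.pi_pi, Finset.prod_mul_distrib]

/-- A Poisson process consists of a Poisson number of i.i.d. points. -/
theorem integral_PRM (ν : Measure E) [IsProbabilityMeasure ν] {b : ℝ} (hb : 0 ≤ b)
    {h : PointMeasure E → ℝ} (hm : Measurable h) {c : ℝ} (hc : ∀ ξ, |h ξ| ≤ c) :
    ∫ ξ, h ξ ∂(PRM (ENNReal.ofReal b • ν)) =
      poissonMean b fun k ↦ ∫ z, h (config z) ∂(Measure.pi fun _ : Fin k ↦ ν) := by
  have : IsFiniteMeasure (ENNReal.ofReal b • ν) := Measure.smul_finite _ ENNReal.ofReal_ne_top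
  have hP := isProbabilityMeasure_PRM (ENNReal.ofReal b • ν)
  have hs := hasSum_integral_measure (integrable_of_abs_le (PRM (ENNReal.ofReal b • ν)) hm hc)
  rw [PRM, ← hs.tsum_eq, poissonMean]
  refine tsum_congr fun k ↦ ?_
  rw [integral_smul_measure, integral_map (measurable_config k).aemeasurable
    hm.aestronglyMeasurable, ENNReal.toReal_ofReal (by positivity), pi_smul_measure,
    integral_smul_measure, ← ENNReal.ofReal_pow hb, ENNReal.toReal_ofReal (by positivity),
    measureReal_def, Measure.smul_apply, measure_univ, poissonWeight]
  simp only [smul_eq_mul, mul_one, ENNReal.toReal_ofReal hb]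
  ring

end Mixture

/-! ### Moving the points, and the general approximation bound. -/

lemma d0_nonneg {E : Type*} [PseudoMetricSpace E] (x y : E) : 0 ≤ d0 x y :=
  le_min dist_nonneg zero_le_one

/-- Matching the points by their index is one admissible transport, so its average cost bounds `d1`.
-/
lemma d1_config_le {E : Type*} [PseudoMetricSpace E] [MeasurableSpace E]
    [MeasurableSingletonClass E] {k : ℕ} (z w : Fin k → E) :
    d1 (config z).1 (config w).1 ≤ (k : ℝ)⁻¹ * ∑ i, d0 (z i) (w i) := by
  have hu : ∀ z : Fin k → E, (config z).1 Set.univ = k := fun z ↦ by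
    simp [config, Measure.finsetSum_apply]
  have hi : ∀ (κ : E → ℝ) (z : Fin k → E), ∫ x, κ x ∂(config z).1 = ∑ i, κ (z i) := fun κ z ↦ by
    simp only [config]
    rw [integral_finsetSum_measure fun i _ ↦ integrable_dirac (by simp)]
    simp
  rw [d1, if_pos ((hu z).trans (hu w).symm), measureReal_def, hu, ENNReal.toReal_natCast]
  refine mul_le_mul_of_nonneg_left (Real.iSup_le (fun κ ↦ ?_)
    (Finset.sum_nonneg fun i _ ↦ d0_nonneg _ _)) (by positivity)
  rw [hi, hi, ← Finset.sum_sub_distrib]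
  exact (Finset.abs_sum_le_sum_abs _ _).trans (Finset.sum_le_sum fun i _ ↦ κ.2 _ _)

section Coupling

variable {E : Type*} [PseudoMetricSpace E] [MeasurableSpace E] [OpensMeasurableSpace E]

lemma measurable_d0 [SecondCountableTopology E] : Measurable fun q : E × E ↦ d0 q.1 q.2 :=
  measurable_dist.min measurable_const

variable [SecondCountableTopology E] [MeasurableSingletonClass E]

/-- Couple every sample point with its own image under `f`. Since `d1` averages over the points, the
bound does not grow with `k`. -/
lemma abs_integral_config_map_sub_le (ν : Measure E) [IsProbabilityMeasure ν] {f : E → E}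
    (hf : Measurable f) (k : ℕ) {h : PointMeasure E → ℝ} (hm : Measurable h) {c : ℝ}
    (hc : ∀ ξ, |h ξ| ≤ c) (hL : ∀ ξ η, |h ξ - h η| ≤ d1 ξ.1 η.1) :
    |∫ z, h (config z) ∂(Measure.pi fun _ : Fin k ↦ ν.map f) -
      ∫ z, h (config z) ∂(Measure.pi fun _ : Fin k ↦ ν)| ≤ ∫ z, d0 (f z) z ∂ν := by
  have := Measure.isProbabilityMeasure_map (μ := ν) hf.aemeasurable
  have hfk : Measurable fun (z : Fin k → E) i ↦ f (z i) :=
    measurable_pi_lambda _ fun i ↦ hf.comp (measurable_pi_apply i)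
  have hmk : Measurable fun z : Fin k → E ↦ h (config z) := hm.comp (measurable_config k)
  have hmfk : Measurable fun z : Fin k → E ↦ h (config fun i ↦ f (z i)) := hmk.comp hfk
  have hd : Measurable fun z ↦ d0 (f z) z := measurable_d0.comp (hf.prodMk measurable_id)
  have hd1 : ∀ z, |d0 (f z) z| ≤ 1 := fun z ↦ by
    rw [abs_of_nonneg (d0_nonneg _ _)]; exact min_le_right _ _
  have hI : 0 ≤ ∫ z, d0 (f z) z ∂ν := integral_nonneg fun z ↦ d0_nonneg _ _
  rw [← Measure.pi_map_pi fun _ ↦ hf.aemeasurable,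
    integral_map hfk.aemeasurable hmk.aestronglyMeasurable,
    ← integral_sub (integrable_of_abs_le _ hmfk fun z ↦ hc _)
      (integrable_of_abs_le _ hmk fun z ↦ hc _)]
  have hi : ∀ i : Fin k, Integrable (fun z : Fin k → E ↦ d0 (f (z i)) (z i))
      (Measure.pi fun _ : Fin k ↦ ν) := fun i ↦
    integrable_of_abs_le _ (hd.comp (measurable_pi_apply i)) (c := 1) fun z ↦ hd1 _
  calc |∫ z, (h (config fun i ↦ f (z i)) - h (config z)) ∂(Measure.pi fun _ : Fin k ↦ ν)|
      ≤ ∫ z, |h (config fun i ↦ f (z i)) - h (config z)| ∂(Measure.pi fun _ : Fin k ↦ ν) :=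
        abs_integral_le_integral_abs
    _ ≤ ∫ z, (k : ℝ)⁻¹ * ∑ i, d0 (f (z i)) (z i) ∂(Measure.pi fun _ : Fin k ↦ ν) := by
        refine integral_mono_of_nonneg (Filter.Eventually.of_forall fun z ↦ abs_nonneg _)
          ((integrable_finsetSum _ fun i _ ↦ hi i).const_mul _)
          (Filter.Eventually.of_forall fun z ↦ ?_)
        exact (hL _ _).trans (d1_config_le _ _)
    _ = (k : ℝ)⁻¹ * ∑ _i : Fin k, ∫ z, d0 (f z) z ∂ν := by
        rw [integral_const_mul, integral_finsetSum _ fun i _ ↦ hi i]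
        congr 1
        refine Finset.sum_congr rfl fun i _ ↦ ?_
        have hmap := (measurePreserving_eval (fun _ : Fin k ↦ ν) i).map_eq
        have h2 := integral_map (μ := Measure.pi fun _ : Fin k ↦ ν)
          (measurable_pi_apply i).aemeasurable hd.aestronglyMeasurable
        exact h2.symm.trans (by rw [hmap])
    _ ≤ _ := by
        -- The product `k⁻¹ * k` is `1`, or `0` when there are no points.
        rw [Finset.sum_const, Finset.card_univ, Fintype.card_fin, nsmul_eq_mul, ← mul_assoc]
        exact mul_le_of_le_one_left hI inv_mul_le_one

/-- Only nonzero counts contribute, and their total weight `1 - e^{-b}` is at most `min b 1`. -/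
lemma abs_poissonMean_sub_le_of_abs_sub_le {b : ℝ} (hb : 0 ≤ b) {H K : ℕ → ℝ} {W : ℝ}
    (h0 : ∀ k, |H k| ≤ 1) (h1 : ∀ k, |K k| ≤ 1) (hz : H 0 = K 0) (hW : ∀ k, |H k - K k| ≤ W) :
    |poissonMean b H - poissonMean b K| ≤ min b 1 * W := by
  have hW0 : 0 ≤ W := (abs_nonneg _).trans (hW 0)
  have hw := hasSum_poissonWeight hb
  have hs := (summable_poissonWeight_mul hb h0).hasSum.sub (summable_poissonWeight_mul hb h1).hasSum
  have hw0 : HasSum (fun k ↦ if k = 0 then 0 else poissonWeight b k) (1 - poissonWeight b 0) := by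
    have e : (fun k ↦ if k = 0 then 0 else poissonWeight b k) =
        fun k ↦ poissonWeight b k - if k = 0 then poissonWeight b 0 else 0 := by
      funext k
      by_cases hk : k = 0 <;> simp [hk]
    rw [e]
    exact hw.sub (hasSum_ite_eq 0 (poissonWeight b 0))
  have hle := tsum_of_norm_bounded (hw0.mul_right W)
    (f := fun k ↦ poissonWeight b k * H k - poissonWeight b k * K k) (by
      intro k
      rcases eq_or_ne k 0 with rfl | hk
      · simp [hz]
      · rw [if_neg hk, ← mul_sub, Real.norm_eq_abs, abs_mul,
          abs_of_nonneg (poissonWeight_nonneg hb k)]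
        exact mul_le_mul_of_nonneg_left (hW k) (poissonWeight_nonneg hb k))
  rw [hs.tsum_eq, Real.norm_eq_abs] at hle
  refine hle.trans (mul_le_mul_of_nonneg_right (le_min ?_ ?_) hW0)
  · simp only [poissonWeight, pow_zero, Nat.factorial_zero, Nat.cast_one]
    linarith [Real.add_one_le_exp (-b)]
  · linarith [poissonWeight_nonneg hb 0]

end Coupling

/-- If the restriction to `A` of the law of i.i.d. points is the image under `f` of a multiple of
`ν`, then the process of the points in `A` is close to a Poisson process with mean measure
proportional to `ν`. -/
theorem d2_map_configIn_PRM_le {E : Type*} [PseudoMetricSpace E] [MeasurableSpace E]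
    [OpensMeasurableSpace E] [SecondCountableTopology E] [MeasurableSingletonClass E]
    {A : Set E} (hA : MeasurableSet A) (μ : Measure E) [IsProbabilityMeasure μ]
    (ν : Measure A) [IsProbabilityMeasure ν] {f : A → A} (hf : Measurable f) {p b : ℝ}
    (hp0 : 0 < p) (hp1 : p ≤ 1) (hμν : μ.comap Subtype.val = ENNReal.ofReal p • ν.map f)
    {n : ℕ} (hn : 1 ≤ n) (hnp : n * p ≤ b) :
    d2 ((Measure.pi fun _ : Fin n ↦ μ).map (configIn A)) (PRM (ENNReal.ofReal b • ν)) ≤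
      p + min (b - n * p) (√b - √(n * p)) + min b 1 * ∫ z, d0 (f z) z ∂ν := by
  have := Measure.isProbabilityMeasure_map (μ := ν) hf.aemeasurable
  have hnp0 : 0 ≤ n * p := by positivity
  have hb : 0 ≤ b := hnp0.trans hnp
  have : IsFiniteMeasure (ENNReal.ofReal b • ν) := Measure.smul_finite _ ENNReal.ofReal_ne_top
  have hPRM := isProbabilityMeasure_PRM (ENNReal.ofReal b • ν)
  have hmap := Measure.isProbabilityMeasure_map (μ := Measure.pi fun _ : Fin n ↦ μ)
    (measurable_configIn hA n).aemeasurable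
  have hI : 0 ≤ ∫ z, d0 (f z) z ∂ν := integral_nonneg fun z ↦ d0_nonneg _ _
  have hmin : 0 ≤ min (b - n * p) (√b - √(n * p)) :=
    le_min (sub_nonneg.2 hnp) (sub_nonneg.2 (Real.sqrt_le_sqrt hnp))
  refine Real.iSup_le (fun ⟨h, hm, hL⟩ ↦ ?_) (by positivity)
  have hosc : ∀ ξ η, |h ξ - h η| ≤ 1 := fun ξ η ↦ by
    have : IsFiniteMeasure ξ.1 := ⟨measure_lt_top ξ _⟩
    have : IsFiniteMeasure η.1 := ⟨measure_lt_top η _⟩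
    exact (hL ξ η).trans (d1_le_one _ _)
  let ξ₀ : PointMeasure A := ⟨0, isPointMeasure_zero⟩
  have hbdd : BddBelow (Set.range h) := by
    refine ⟨h ξ₀ - 1, ?_⟩
    rintro _ ⟨ξ, rfl⟩
    linarith [abs_le.1 (hosc ξ₀ ξ)]
  have : Nonempty (PointMeasure A) := ⟨ξ₀⟩
  -- Subtracting the infimum brings `h` into `[0, 1]`, as the comparisons of the counts require; the
  -- shift cancels between two probability measures.
  set m := ⨅ ξ, h ξ
  set g : PointMeasure A → ℝ := fun ξ ↦ h ξ - m with hg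
  have g0 : ∀ ξ, 0 ≤ g ξ := fun ξ ↦ sub_nonneg.2 (ciInf_le hbdd ξ)
  have g1 : ∀ ξ, g ξ ≤ 1 := fun ξ ↦ by
    have : h ξ - 1 ≤ m := le_ciInf fun η ↦ by linarith [abs_le.1 (hosc ξ η)]
    simp only [hg]; linarith
  have gabs : ∀ ξ, |g ξ| ≤ 1 := fun ξ ↦ by rw [abs_of_nonneg (g0 ξ)]; exact g1 ξ
  have gm : Measurable g := hm.sub_const _
  have gL : ∀ ξ η, |g ξ - g η| ≤ d1 ξ.1 η.1 := fun ξ η ↦ by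
    simpa [hg] using hL ξ η
  have hint : ∀ (Q : Measure (PointMeasure A)) [IsProbabilityMeasure Q],
      ∫ ξ, h ξ ∂Q = ∫ ξ, g ξ ∂Q + m := fun Q _ ↦ by
    have := integral_add (integrable_of_abs_le Q gm gabs) (integrable_const m)
    simpa [hg] using this
  simp only
  rw [hint, hint, add_sub_add_right_eq_sub, integral_map (measurable_configIn hA n).aemeasurable
    gm.aestronglyMeasurable, integral_configIn hA μ (ν.map f) hp0.le hμν n gm gabs,
    integral_PRM ν hb gm gabs]
  set H : ℕ → ℝ := fun k ↦ ∫ z, g (config z) ∂(Measure.pi fun _ : Fin k ↦ ν.map f)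
  set K : ℕ → ℝ := fun k ↦ ∫ z, g (config z) ∂(Measure.pi fun _ : Fin k ↦ ν)
  have Habs : ∀ k, |H k| ≤ 1 := fun k ↦ abs_integral_le_of_abs_le _ fun z ↦ gabs _
  have Kabs : ∀ k, |K k| ≤ 1 := fun k ↦ abs_integral_le_of_abs_le _ fun z ↦ gabs _
  have H0 : ∀ k, 0 ≤ H k := fun k ↦ integral_nonneg fun z ↦ g0 _
  have H1 : ∀ k, H k ≤ 1 := fun k ↦ (abs_le.1 (Habs k)).2
  -- With no points, the law of a single point is irrelevant.
  have hHK0 : H 0 = K 0 := by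
    simp only [H, K]
    rw [Measure.pi_of_empty, Measure.pi_of_empty]
  have b1 := abs_binomialMean_sub_poissonMean_le hp0 hp1 hn H0 H1
  have b2 := le_min (abs_poissonMean_sub_le hnp0 hnp H0 H1)
    (abs_poissonMean_sub_le_sqrt hnp0 hnp H0 H1)
  have b3 := abs_poissonMean_sub_le_of_abs_sub_le hb Habs Kabs hHK0
    fun k ↦ abs_integral_config_map_sub_le ν hf k gm gabs gL
  calc _ = |(binomialMean p n H - poissonMean (n * p) H) +
        (poissonMean (n * p) H - poissonMean b H) + (poissonMean b H - poissonMean b K)| := by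
        congr 1; ring
    _ ≤ _ := (abs_add_three _ _ _).trans (add_le_add (add_le_add b1 b2) b3)

end PointProcess

/-! ### Exponential integrals over the cells of a rounding map. -/

section ExponentialIntegrals

lemma setLIntegral_exp_neg_Ioi {β : ℝ} (hβ : 0 < β) (a : ℝ) :
    ∫⁻ x in Set.Ioi a, ENNReal.ofReal (Real.exp (-(β * x))) =
      ENNReal.ofReal (Real.exp (-(β * a)) / β) := by
  have h := integral_exp_mul_Ioi (neg_lt_zero.2 hβ) a
  have hi : IntegrableOn (fun x ↦ Real.exp (-β * x)) (Set.Ioi a) :=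
    integrableOn_exp_mul_Ioi (neg_lt_zero.2 hβ) a
  simp only [neg_mul] at h hi
  rw [← ofReal_integral_eq_lintegral_ofReal hi
    (Filter.Eventually.of_forall fun x ↦ (Real.exp_pos _).le), h, neg_div_neg_eq]

lemma setLIntegral_exp_neg_Ioc {β : ℝ} (hβ : 0 < β) {a b : ℝ} (hab : a ≤ b) :
    ∫⁻ x in Set.Ioc a b, ENNReal.ofReal (Real.exp (-(β * x))) =
      ENNReal.ofReal ((Real.exp (-(β * a)) - Real.exp (-(β * b))) / β) := by
  have hc : Continuous fun x ↦ Real.exp (-(β * x)) := by fun_prop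
  have hd : ∀ x, HasDerivAt (fun x ↦ -Real.exp (-(β * x)) / β) (Real.exp (-(β * x))) x := fun x ↦ by
    have h : HasDerivAt (fun x ↦ -(β * x)) (-(β * 1)) x :=
      ((hasDerivAt_id' x).const_mul β).neg
    exact (h.exp.neg.div_const β).congr_deriv (by field_simp)
  have h := intervalIntegral.integral_eq_sub_of_hasDerivAt (a := a) (b := b) (fun x _ ↦ hd x)
    (hc.intervalIntegrable a b)
  rw [intervalIntegral.integral_of_le hab] at h
  rw [← ofReal_integral_eq_lintegral_ofReal (hc.integrableOn_Ioc)
    (Filter.Eventually.of_forall fun x ↦ (Real.exp_pos _).le), h]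
  congr 1
  ring

lemma setLIntegral_mul_exp_neg_Ioi {β : ℝ} (hβ : 0 < β) :
    ∫⁻ x in Set.Ioi (0 : ℝ), ENNReal.ofReal x * ENNReal.ofReal (Real.exp (-(β * x))) =
      ENNReal.ofReal (1 / β ^ 2) := by
  have h := Real.integral_rpow_mul_exp_neg_mul_Ioi two_pos hβ
  have e : ∀ x : ℝ, x ^ ((2 : ℝ) - 1) = x := fun x ↦ by norm_num
  simp only [e, Real.Gamma_two, mul_one, Real.rpow_ofNat, one_div, inv_pow] at h
  have hi : IntegrableOn (fun x ↦ x * Real.exp (-(β * x))) (Set.Ioi 0) := by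
    -- The integral of a non-integrable function is `0` by convention, whereas `h` gives a positive
    -- value.
    by_contra hn
    rw [integral_undef hn] at h
    exact (by positivity : (β ^ 2)⁻¹ ≠ 0) h.symm
  rw [one_div, ← h, ofReal_integral_eq_lintegral_ofReal hi]
  · refine setLIntegral_congr_fun measurableSet_Ioi fun x hx ↦ ?_
    exact (ENNReal.ofReal_mul (le_of_lt hx)).symm
  · filter_upwards [ae_restrict_mem measurableSet_Ioi] with x hx
    exact mul_nonneg (le_of_lt hx) (Real.exp_pos _).le

/-- The exponential distribution on an interval on which the integer part is constant. -/
lemma lintegral_floor_eq {r : ℝ} (hr : 0 < r) (u : ℝ) (m : ℕ) :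
    ∫⁻ s, {s : ℝ | u ≤ s ∧ ⌊(s - u) / r⌋₊ = m}.indicator 1 s * ENNReal.ofReal (Real.exp (-s)) =
      ENNReal.ofReal (Real.exp (-u) * (Real.exp (-r) ^ m * (1 - Real.exp (-r)))) := by
  have hset : {s : ℝ | u ≤ s ∧ ⌊(s - u) / r⌋₊ = m} = Set.Ico (u + r * m) (u + r * (m + 1)) := by
    ext s
    simp only [Set.mem_ofPred_eq, Set.mem_Ico]
    constructor
    · rintro ⟨h1, h2⟩
      rw [Nat.floor_eq_iff (div_nonneg (sub_nonneg.2 h1) hr.le), le_div_iff₀ hr, div_lt_iff₀ hr]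
        at h2
      constructor <;> linarith [h2.1, h2.2]
    · rintro ⟨h1, h2⟩
      have h3 : u ≤ s := by
        have : 0 ≤ r * m := by positivity
        linarith
      refine ⟨h3, ?_⟩
      rw [Nat.floor_eq_iff (div_nonneg (sub_nonneg.2 h3) hr.le), le_div_iff₀ hr, div_lt_iff₀ hr]
      constructor <;> linarith
  have e : ∀ s, (Set.Ico (u + r * m) (u + r * (m + 1))).indicator 1 s *
      ENNReal.ofReal (Real.exp (-s)) = (Set.Ico (u + r * m) (u + r * (m + 1))).indicator
      (fun s ↦ ENNReal.ofReal (Real.exp (-(1 * s)))) s := fun s ↦ by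
    by_cases hs : s ∈ Set.Ico (u + r * m) (u + r * (m + 1)) <;> simp [hs]
  rw [hset]
  simp_rw [e]
  rw [lintegral_indicator measurableSet_Ico, setLIntegral_congr Ico_ae_eq_Ioc,
    setLIntegral_exp_neg_Ioc one_pos (by nlinarith)]
  congr 1
  rw [div_one, ← Real.exp_nat_mul, mul_sub, mul_sub, mul_one, ← Real.exp_add, ← Real.exp_add,
    ← Real.exp_add]
  congr 2 <;> ring

/-- The exponential distribution on an interval on which the rounded up value is constant. -/
lemma setLIntegral_ceil_eq {β κ : ℝ} (hβ : 0 < β) (hκ : 0 < κ) (j : ℕ) :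
    ∫⁻ y in Set.Ioi (0 : ℝ), {y : ℝ | ⌈y / κ⌉₊ = j + 1}.indicator 1 y *
        ENNReal.ofReal (Real.exp (-(β * y))) =
      ENNReal.ofReal (Real.exp (-(β * κ)) ^ j * (1 - Real.exp (-(β * κ))) / β) := by
  have hset : {y : ℝ | ⌈y / κ⌉₊ = j + 1} = Set.Ioc (κ * j) (κ * (j + 1)) := by
    ext y
    simp only [Set.mem_ofPred_eq, Set.mem_Ioc]
    rw [Nat.ceil_eq_iff (Nat.succ_ne_zero j), lt_div_iff₀ hκ, div_le_iff₀ hκ]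
    push_cast [Nat.add_sub_cancel]
    rw [mul_comm κ, mul_comm κ]
  have hsub : Set.Ioc (κ * j) (κ * (j + 1)) ⊆ Set.Ioi (0 : ℝ) := fun y hy ↦
    lt_of_le_of_lt (by positivity) hy.1
  have e : ∀ y, (Set.Ioc (κ * j) (κ * (j + 1))).indicator 1 y *
      ENNReal.ofReal (Real.exp (-(β * y))) = (Set.Ioc (κ * j) (κ * (j + 1))).indicator
      (fun y ↦ ENNReal.ofReal (Real.exp (-(β * y)))) y := fun y ↦ by
    by_cases hs : y ∈ Set.Ioc (κ * j) (κ * (j + 1)) <;> simp [hs]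
  rw [hset]
  simp_rw [e]
  rw [setLIntegral_indicator measurableSet_Ioc, Set.inter_eq_left.2 hsub,
    setLIntegral_exp_neg_Ioc hβ (by nlinarith)]
  congr 2
  rw [← Real.exp_nat_mul, mul_sub, mul_one, ← Real.exp_add]
  congr 2 <;> ring

end ExponentialIntegrals

/-! ### Integration with respect to the limiting intensity. -/

namespace MarshallOlkin

lemma measurable_mk : Measurable fun p : ℝ × ℝ ↦ (!₂[p.1, p.2] : Plane) := by
  refine (WithLp.measurable_toLp 2 (Fin 2 → ℝ)).comp (measurable_pi_lambda _ fun i ↦ ?_)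
  fin_cases i
  · exact measurable_fst
  · exact measurable_snd

lemma measurable_coord (i : Fin 2) : Measurable fun z : Plane ↦ z i :=
  (measurable_pi_apply i).comp (WithLp.measurable_ofLp 2 (Fin 2 → ℝ))

lemma lintegral_plane {G : Plane → ℝ≥0∞} (hG : Measurable G) :
    ∫⁻ z, G z = ∫⁻ s : ℝ, ∫⁻ t : ℝ, G !₂[s, t] := by
  have hmp := (volume_preserving_finTwoArrow ℝ).comp
    (EuclideanSpace.volume_preserving_symm_measurableEquiv_toLp (Fin 2))
  have h := hmp.lintegral_comp (hG.comp measurable_mk)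
  rw [Measure.volume_eq_prod, lintegral_prod _ (hG.comp measurable_mk).aemeasurable] at h
  refine Eq.trans (lintegral_congr fun z ↦ ?_) h
  congr 1
  ext i
  fin_cases i <;> rfl

lemma measurable_offDiagonalIntensity (γ δ : ℝ) : Measurable (offDiagonalIntensity γ δ) := by
  have h0 := measurable_coord 0
  have h1 := measurable_coord 1
  unfold offDiagonalIntensity
  refine Measurable.ite (measurableSet_lt h0 h1) (by fun_prop)
    (Measurable.ite (measurableSet_lt h1 h0) (by fun_prop) measurable_const)

/-- Substitute `t = s + y`. As `a + β = 1`, the exponent `-a s - β t` becomes `-s - β y`, which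
separates the smaller coordinate from the excess. -/
lemma lintegral_lt_shift {C a β : ℝ} (hC : 0 ≤ C) (hab : a + β = 1) {f : ℝ → ℝ → ℝ≥0∞} :
    ∫⁻ s : ℝ, ∫⁻ t : ℝ, (if s < t then
        ENNReal.ofReal (C * Real.exp (-a * s) * Real.exp (-β * t)) * f s t else 0) =
      ENNReal.ofReal C * ∫⁻ s : ℝ, ∫⁻ y in Set.Ioi (0 : ℝ), f s (s + y) *
        (ENNReal.ofReal (Real.exp (-s)) * ENNReal.ofReal (Real.exp (-(β * y)))) := by
  rw [← lintegral_const_mul' _ _ ENNReal.ofReal_ne_top]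
  refine lintegral_congr fun s ↦ ?_
  rw [← lintegral_const_mul' _ _ ENNReal.ofReal_ne_top,
    ← lintegral_indicator measurableSet_Ioi, ← lintegral_add_left_eq_self _ s]
  refine lintegral_congr fun y ↦ ?_
  by_cases hy : 0 < y
  · rw [if_pos (by linarith), Set.indicator_of_mem (by exact hy), mul_assoc,
      ENNReal.ofReal_mul hC, mul_assoc, ← ENNReal.ofReal_mul (Real.exp_pos _).le, ← Real.exp_add,
      ← Real.exp_add, mul_comm (f _ _)]
    congr 4
    linear_combination -s * hab
  · rw [if_neg (by linarith), Set.indicator_of_notMem (by exact hy)]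

/-- Integration with respect to the limiting intensity, in terms of the smaller coordinate and the
excess of the larger one. -/
lemma lintegral_intensityMeasure {γ δ : ℝ} (hγ : 0 < γ) (hδ : 0 < δ) {F : Plane → ℝ≥0∞}
    (hF : Measurable F) :
    ∫⁻ z, F z ∂(intensityMeasure γ δ) =
      ENNReal.ofReal (γ * (1 + δ) / (1 + γ + δ) ^ 2) *
        (∫⁻ s : ℝ, ∫⁻ y in Set.Ioi (0 : ℝ), F !₂[s, s + y] * (ENNReal.ofReal (Real.exp (-s)) *
          ENNReal.ofReal (Real.exp (-((1 + δ) / (1 + γ + δ) * y))))) +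
      ENNReal.ofReal (δ * (1 + γ) / (1 + γ + δ) ^ 2) *
        (∫⁻ s : ℝ, ∫⁻ y in Set.Ioi (0 : ℝ), F !₂[s + y, s] * (ENNReal.ofReal (Real.exp (-s)) *
          ENNReal.ofReal (Real.exp (-((1 + γ) / (1 + γ + δ) * y))))) +
      ENNReal.ofReal (1 / (1 + γ + δ)) *
        ∫⁻ s : ℝ, F !₂[s, s] * ENNReal.ofReal (Real.exp (-s)) := by
  have hM : 0 < 1 + γ + δ := by positivity
  have hdiag : Measurable fun s : ℝ ↦ (!₂[s, s] : Plane) :=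
    measurable_mk.comp (measurable_id.prodMk measurable_id)
  have hoff : Measurable fun z ↦ ENNReal.ofReal (offDiagonalIntensity γ δ z) :=
    (measurable_offDiagonalIntensity γ δ).ennreal_ofReal
  have hdi : Measurable fun s ↦ ENNReal.ofReal (diagonalIntensity γ δ s) := by
    unfold diagonalIntensity
    fun_prop
  rw [intensityMeasure, lintegral_add_measure, lintegral_map hF hdiag,
    lintegral_withDensity_eq_lintegral_mul _ hoff hF,
    lintegral_withDensity_eq_lintegral_mul _ hdi (show Measurable fun s : ℝ ↦ F !₂[s, s] from hF.comp hdiag), lintegral_plane (hoff.mul hF)]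
  congr 1
  · have hsplit : ∀ s t : ℝ, ((fun z ↦ ENNReal.ofReal (offDiagonalIntensity γ δ z)) * F) !₂[s, t] =
        (if s < t then ENNReal.ofReal (γ * (1 + δ) / (1 + γ + δ) ^ 2 *
          Real.exp (-(γ / (1 + γ + δ)) * s) * Real.exp (-((1 + δ) / (1 + γ + δ)) * t)) *
            F !₂[s, t] else 0) +
        (if t < s then ENNReal.ofReal (δ * (1 + γ) / (1 + γ + δ) ^ 2 *
          Real.exp (-(δ / (1 + γ + δ)) * t) * Real.exp (-((1 + γ) / (1 + γ + δ)) * s)) *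
            F !₂[s, t] else 0) := fun s t ↦ by
      simp only [Pi.mul_apply, offDiagonalIntensity]
      change ENNReal.ofReal (if s < t then _ * Real.exp (_ * s) * Real.exp (_ * t) else
        if t < s then _ * Real.exp (_ * s) * Real.exp (_ * t) else 0) * _ = _
      rcases lt_trichotomy s t with h | h | h
      · simp [h, h.not_gt]
      · simp [h]
      · rw [if_neg h.not_gt, if_pos h, if_neg h.not_gt, if_pos h, zero_add, mul_right_comm]
    have hFm : Measurable fun q : ℝ × ℝ ↦ F !₂[q.1, q.2] := hF.comp measurable_mk
    have hm1 : Measurable fun q : ℝ × ℝ ↦ (if q.1 < q.2 then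
        ENNReal.ofReal (γ * (1 + δ) / (1 + γ + δ) ^ 2 *
          Real.exp (-(γ / (1 + γ + δ)) * q.1) * Real.exp (-((1 + δ) / (1 + γ + δ)) * q.2)) *
            F !₂[q.1, q.2] else 0) :=
      Measurable.ite (measurableSet_lt measurable_fst measurable_snd)
        (Measurable.mul (by fun_prop) hFm) measurable_const
    have hm2 : Measurable fun q : ℝ × ℝ ↦ (if q.2 < q.1 then
        ENNReal.ofReal (δ * (1 + γ) / (1 + γ + δ) ^ 2 *
          Real.exp (-(δ / (1 + γ + δ)) * q.2) * Real.exp (-((1 + γ) / (1 + γ + δ)) * q.1)) *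
            F !₂[q.1, q.2] else 0) :=
      Measurable.ite (measurableSet_lt measurable_snd measurable_fst)
        (Measurable.mul (by fun_prop) hFm) measurable_const
    simp_rw [hsplit]
    have e1 : ∀ s : ℝ, Measurable fun t : ℝ ↦ (if s < t then
        ENNReal.ofReal (γ * (1 + δ) / (1 + γ + δ) ^ 2 *
          Real.exp (-(γ / (1 + γ + δ)) * s) * Real.exp (-((1 + δ) / (1 + γ + δ)) * t)) *
            F !₂[s, t] else 0) := fun s ↦ hm1.comp measurable_prodMk_left
    rw [lintegral_congr fun s ↦ lintegral_add_left (e1 s) _, lintegral_add_left hm1.lintegral_prod_right']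
    congr 1
    · exact lintegral_lt_shift (f := fun s t ↦ F !₂[s, t]) (by positivity) (by field_simp; ring)
    -- Below the diagonal `t` is the smaller coordinate, so it must become the outer variable before
    -- the shift.
    · rw [lintegral_lintegral_swap (f := fun s t : ℝ ↦ (if t < s then
        ENNReal.ofReal (δ * (1 + γ) / (1 + γ + δ) ^ 2 *
          Real.exp (-(δ / (1 + γ + δ)) * t) * Real.exp (-((1 + γ) / (1 + γ + δ)) * s)) *
            F !₂[s, t] else 0)) hm2.aemeasurable]
      exact lintegral_lt_shift (f := fun t s ↦ F !₂[s, t]) (by positivity) (by field_simp; ring)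
  · rw [← lintegral_const_mul' _ _ ENNReal.ofReal_ne_top]
    refine lintegral_congr fun s ↦ ?_
    simp only [Pi.mul_apply, diagonalIntensity]
    rw [ENNReal.ofReal_mul (by positivity), mul_assoc, mul_comm (F _)]

/-- The smaller coordinate and the excess are independent under the intensity. Cells, total mass and
mean excess all have integrands that split in this way, so one product formula serves them all. -/
lemma lintegral_intensityMeasure_of_factor {γ δ : ℝ} (hγ : 0 < γ) (hδ : 0 < δ) {F : Plane → ℝ≥0∞}
    (hF : Measurable F) {ρ g₁ g₂ : ℝ → ℝ≥0∞} {c : ℝ≥0∞} (hρ : Measurable ρ)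
    (hg₁ : Measurable g₁) (hg₂ : Measurable g₂)
    (h₁ : ∀ s y, 0 < y → F !₂[s + y, s] = ρ s * g₁ y)
    (h₂ : ∀ s y, 0 < y → F !₂[s, s + y] = ρ s * g₂ y) (h₀ : ∀ s, F !₂[s, s] = ρ s * c) :
    ∫⁻ z, F z ∂(intensityMeasure γ δ) =
      (∫⁻ s, ρ s * ENNReal.ofReal (Real.exp (-s))) *
        (ENNReal.ofReal (γ * (1 + δ) / (1 + γ + δ) ^ 2) *
          (∫⁻ y in Set.Ioi (0 : ℝ), g₂ y *
            ENNReal.ofReal (Real.exp (-((1 + δ) / (1 + γ + δ) * y)))) +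
        ENNReal.ofReal (δ * (1 + γ) / (1 + γ + δ) ^ 2) *
          (∫⁻ y in Set.Ioi (0 : ℝ), g₁ y *
            ENNReal.ofReal (Real.exp (-((1 + γ) / (1 + γ + δ) * y)))) +
        ENNReal.ofReal (1 / (1 + γ + δ)) * c) := by
  have key : ∀ (f : ℝ → ℝ → ℝ≥0∞) (g : ℝ → ℝ≥0∞) (β : ℝ), Measurable g →
      (∀ s y, 0 < y → f s y = ρ s * g y) →
      ∫⁻ s : ℝ, ∫⁻ y in Set.Ioi (0 : ℝ), f s y * (ENNReal.ofReal (Real.exp (-s)) *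
          ENNReal.ofReal (Real.exp (-(β * y)))) =
        (∫⁻ s, ρ s * ENNReal.ofReal (Real.exp (-s))) *
          ∫⁻ y in Set.Ioi (0 : ℝ), g y * ENNReal.ofReal (Real.exp (-(β * y))) := by
    intro f g β hg hf
    rw [← lintegral_mul_const _ (by fun_prop)]
    refine lintegral_congr fun s ↦ ?_
    rw [← lintegral_const_mul _ (by fun_prop)]
    refine setLIntegral_congr_fun measurableSet_Ioi fun y hy ↦ ?_
    simp only [hf s y hy]
    ring
  rw [lintegral_intensityMeasure hγ hδ hF, key _ g₂ _ hg₂ h₂, key _ g₁ _ hg₁ h₁]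
  have h3 : ∫⁻ s : ℝ, F !₂[s, s] * ENNReal.ofReal (Real.exp (-s)) =
      (∫⁻ s, ρ s * ENNReal.ofReal (Real.exp (-s))) * c := by
    rw [← lintegral_mul_const _ (by fun_prop)]
    refine lintegral_congr fun s ↦ ?_
    rw [h₀]
    ring
  rw [h3]
  ring

end MarshallOlkin

/-! ### Rounding the limit measure to the geometric law. -/

namespace MarshallOlkin

lemma measurableSet_quadrant (u : ℝ) : MeasurableSet (quadrant u) :=
  (measurableSet_le measurable_const (measurable_coord 0)).inter
    (measurableSet_le measurable_const (measurable_coord 1))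

/-- The lattice point next to `z`: the smaller coordinate is rounded down to a multiple of `r`,
counted from `u` and starting with the number `k`, and the excess of the larger coordinate is
rounded up to a multiple of `κ₁` or `κ₂`. -/
noncomputable def latticePoint (r κ₁ κ₂ u : ℝ) (k : ℕ) (z : Plane) : ℕ × ℕ :=
  (k + ⌊(min (z 0) (z 1) - u) / r⌋₊ + ⌈(z 0 - z 1) / κ₁⌉₊,
    k + ⌊(min (z 0) (z 1) - u) / r⌋₊ + ⌈(z 1 - z 0) / κ₂⌉₊)

lemma measurable_latticePoint (r κ₁ κ₂ u : ℝ) (k : ℕ) :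
    Measurable (latticePoint r κ₁ κ₂ u k) := by
  have h0 := measurable_coord 0
  have h1 := measurable_coord 1
  have hf : Measurable fun z : Plane ↦ ⌊(min (z 0) (z 1) - u) / r⌋₊ :=
    Nat.measurable_floor.comp (((h0.min h1).sub_const u).div_const r)
  have hc1 : Measurable fun z : Plane ↦ ⌈(z 0 - z 1) / κ₁⌉₊ :=
    Nat.measurable_ceil.comp ((h0.sub h1).div_const κ₁)
  have hc2 : Measurable fun z : Plane ↦ ⌈(z 1 - z 0) / κ₂⌉₊ :=
    Nat.measurable_ceil.comp ((h1.sub h0).div_const κ₂)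
  exact ((hf.const_add k).add hc1).prodMk ((hf.const_add k).add hc2)

lemma latticePoint_add_right {r κ₁ κ₂ u : ℝ} (hκ₁ : 0 < κ₁) (k : ℕ) (s : ℝ) {y : ℝ} (hy : 0 ≤ y) :
    latticePoint r κ₁ κ₂ u k (!₂[s, s + y]) =
      (k + ⌊(s - u) / r⌋₊, k + ⌊(s - u) / r⌋₊ + ⌈y / κ₂⌉₊) := by
  have h : ⌈(s - (s + y)) / κ₁⌉₊ = 0 :=
    Nat.ceil_eq_zero.2 (div_nonpos_of_nonpos_of_nonneg (by linarith) hκ₁.le)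
  simp only [latticePoint]
  change (k + ⌊(min s (s + y) - u) / r⌋₊ + ⌈(s - (s + y)) / κ₁⌉₊,
    k + ⌊(min s (s + y) - u) / r⌋₊ + ⌈(s + y - s) / κ₂⌉₊) = _
  rw [h, min_eq_left (by linarith), add_sub_cancel_left, add_zero]

lemma latticePoint_add_left {r κ₁ κ₂ u : ℝ} (hκ₂ : 0 < κ₂) (k : ℕ) (s : ℝ) {y : ℝ} (hy : 0 ≤ y) :
    latticePoint r κ₁ κ₂ u k (!₂[s + y, s]) =
      (k + ⌊(s - u) / r⌋₊ + ⌈y / κ₁⌉₊, k + ⌊(s - u) / r⌋₊) := by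
  have h : ⌈(s - (s + y)) / κ₂⌉₊ = 0 :=
    Nat.ceil_eq_zero.2 (div_nonpos_of_nonpos_of_nonneg (by linarith) hκ₂.le)
  simp only [latticePoint]
  change (k + ⌊(min (s + y) s - u) / r⌋₊ + ⌈(s + y - s) / κ₁⌉₊,
    k + ⌊(min (s + y) s - u) / r⌋₊ + ⌈(s - (s + y)) / κ₂⌉₊) = _
  rw [h, min_eq_right (by linarith), add_sub_cancel_left, add_zero]

lemma mk_mem_quadrant {u s t : ℝ} : (!₂[s, t] : Plane) ∈ quadrant u ↔ u ≤ s ∧ u ≤ t := Iff.rfl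

lemma add_right_mem_quadrant {u s y : ℝ} (hy : 0 ≤ y) :
    (!₂[s, s + y] : Plane) ∈ quadrant u ↔ u ≤ s := by
  rw [mk_mem_quadrant, and_iff_left_iff_imp]
  intro h
  linarith

lemma add_left_mem_quadrant {u s y : ℝ} (hy : 0 ≤ y) :
    (!₂[s + y, s] : Plane) ∈ quadrant u ↔ u ≤ s := by
  rw [mk_mem_quadrant, and_iff_right_iff_imp]
  intro h
  linarith

section Cells

variable {γ δ r κ₁ κ₂ : ℝ}

lemma indicator_eq_mul {X Y Z : Type*} {S : Set X} {A : Set Y} {B : Set Z} {x : X} {y : Y} {z : Z}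
    (h : x ∈ S ↔ y ∈ A ∧ z ∈ B) :
    S.indicator (1 : X → ℝ≥0∞) x = A.indicator 1 y * B.indicator 1 z := by
  by_cases hA : y ∈ A <;> by_cases hB : z ∈ B <;> simp [h, hA, hB]

lemma measurable_indicator_floor (r u : ℝ) (m : ℕ) :
    Measurable ({s : ℝ | u ≤ s ∧ ⌊(s - u) / r⌋₊ = m}.indicator (1 : ℝ → ℝ≥0∞)) := by
  refine measurable_one.indicator (measurableSet_Ici.inter ?_)
  have : Measurable fun s : ℝ ↦ ⌊(s - u) / r⌋₊ :=
    Nat.measurable_floor.comp ((measurable_id.sub_const u).div_const r)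
  exact this (measurableSet_singleton m)

lemma measurable_indicator_ceil (κ : ℝ) (j : ℕ) :
    Measurable ({y : ℝ | ⌈y / κ⌉₊ = j}.indicator (1 : ℝ → ℝ≥0∞)) := by
  have : Measurable fun y : ℝ ↦ ⌈y / κ⌉₊ := Nat.measurable_ceil.comp (measurable_id.div_const κ)
  exact measurable_one.indicator (this (measurableSet_singleton j))

lemma measurableSet_cell (r κ₁ κ₂ u : ℝ) (k : ℕ) (x : ℕ × ℕ) :
    MeasurableSet (latticePoint r κ₁ κ₂ u k ⁻¹' {x} ∩ quadrant u) :=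
  (measurable_latticePoint r κ₁ κ₂ u k (measurableSet_singleton x)).inter (measurableSet_quadrant u)

/-- The cell consists of the points above the diagonal whose smaller coordinate has rounded value
`m` and whose excess has rounded value `j + 1`. Its mass is therefore a product of two geometric
probabilities, up to constants; the diagonal and the other side contribute nothing. -/
lemma intensityMeasure_cell_lt (hγ : 0 < γ) (hδ : 0 < δ) (hr : 0 < r) (hκ₁ : 0 < κ₁)
    (hκ₂ : 0 < κ₂) (u : ℝ) (k m j : ℕ) :
    intensityMeasure γ δ (latticePoint r κ₁ κ₂ u k ⁻¹' {(k + m, k + m + (j + 1))} ∩ quadrant u) =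
      ENNReal.ofReal (Real.exp (-u) * (Real.exp (-r) ^ m * (1 - Real.exp (-r))) *
        (γ * (1 + δ) / (1 + γ + δ) ^ 2 * (Real.exp (-((1 + δ) / (1 + γ + δ) * κ₂)) ^ j *
          (1 - Real.exp (-((1 + δ) / (1 + γ + δ) * κ₂))) / ((1 + δ) / (1 + γ + δ))))) := by
  have hS := measurableSet_cell r κ₁ κ₂ u k (k + m, k + m + (j + 1))
  have hr1 : Real.exp (-r) ≤ 1 := Real.exp_le_one_iff.2 (by linarith)
  rw [← lintegral_indicator_one hS, lintegral_intensityMeasure_of_factor hγ hδ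
    (measurable_one.indicator hS) (measurable_indicator_floor r u m) (g₁ := 0) (c := 0)
    measurable_zero (measurable_indicator_ceil κ₂ (j + 1))]
  · rw [lintegral_floor_eq hr, setLIntegral_ceil_eq (by positivity) hκ₂]
    simp only [Pi.zero_apply, zero_mul, lintegral_zero, mul_zero, add_zero]
    rw [← ENNReal.ofReal_mul (by positivity), ← ENNReal.ofReal_mul]
    exact mul_nonneg (Real.exp_pos _).le (mul_nonneg (by positivity) (by linarith))
  · intro s y hy
    simp only [Pi.zero_apply, mul_zero]
    refine Set.indicator_of_notMem (fun h ↦ ?_) _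
    have h1 := h.1
    simp only [Set.mem_preimage, latticePoint_add_left hκ₂ k s hy.le, Set.mem_singleton_iff,
      Prod.mk.injEq] at h1
    omega
  · intro s y hy
    refine indicator_eq_mul ?_
    simp only [Set.mem_inter_iff, Set.mem_preimage, latticePoint_add_right hκ₁ k s hy.le,
      Set.mem_singleton_iff, Prod.mk.injEq, add_right_mem_quadrant hy.le, Set.mem_ofPred_eq]
    constructor
    · rintro ⟨⟨h1, h2⟩, h3⟩
      exact ⟨⟨h3, by omega⟩, by omega⟩
    · rintro ⟨⟨h1, h2⟩, h3⟩
      exact ⟨⟨by omega, by omega⟩, h1⟩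
  · intro s
    simp only [mul_zero]
    refine Set.indicator_of_notMem (fun h ↦ ?_) _
    have h1 := h.1
    have h2 := latticePoint_add_left (r := r) (κ₁ := κ₁) (u := u) hκ₂ k s le_rfl
    simp only [add_zero, zero_div, Nat.ceil_zero] at h2
    simp only [Set.mem_preimage, h2, Set.mem_singleton_iff, Prod.mk.injEq] at h1
    omega

lemma intensityMeasure_cell_gt (hγ : 0 < γ) (hδ : 0 < δ) (hr : 0 < r) (hκ₁ : 0 < κ₁)
    (hκ₂ : 0 < κ₂) (u : ℝ) (k m j : ℕ) :
    intensityMeasure γ δ (latticePoint r κ₁ κ₂ u k ⁻¹' {(k + m + (j + 1), k + m)} ∩ quadrant u) =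
      ENNReal.ofReal (Real.exp (-u) * (Real.exp (-r) ^ m * (1 - Real.exp (-r))) *
        (δ * (1 + γ) / (1 + γ + δ) ^ 2 * (Real.exp (-((1 + γ) / (1 + γ + δ) * κ₁)) ^ j *
          (1 - Real.exp (-((1 + γ) / (1 + γ + δ) * κ₁))) / ((1 + γ) / (1 + γ + δ))))) := by
  have hS := measurableSet_cell r κ₁ κ₂ u k (k + m + (j + 1), k + m)
  have hr1 : Real.exp (-r) ≤ 1 := Real.exp_le_one_iff.2 (by linarith)
  rw [← lintegral_indicator_one hS, lintegral_intensityMeasure_of_factor hγ hδ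
    (measurable_one.indicator hS) (measurable_indicator_floor r u m) (g₂ := 0) (c := 0)
    (measurable_indicator_ceil κ₁ (j + 1)) measurable_zero]
  · rw [lintegral_floor_eq hr, setLIntegral_ceil_eq (by positivity) hκ₁]
    simp only [Pi.zero_apply, zero_mul, lintegral_zero, mul_zero, add_zero, zero_add]
    rw [← ENNReal.ofReal_mul (by positivity), ← ENNReal.ofReal_mul]
    exact mul_nonneg (Real.exp_pos _).le (mul_nonneg (by positivity) (by linarith))
  · intro s y hy
    refine indicator_eq_mul ?_
    simp only [Set.mem_inter_iff, Set.mem_preimage, latticePoint_add_left hκ₂ k s hy.le,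
      Set.mem_singleton_iff, Prod.mk.injEq, add_left_mem_quadrant hy.le, Set.mem_ofPred_eq]
    constructor
    · rintro ⟨⟨h1, h2⟩, h3⟩
      exact ⟨⟨h3, by omega⟩, by omega⟩
    · rintro ⟨⟨h1, h2⟩, h3⟩
      exact ⟨⟨by omega, by omega⟩, h1⟩
  · intro s y hy
    simp only [Pi.zero_apply, mul_zero]
    refine Set.indicator_of_notMem (fun h ↦ ?_) _
    have h1 := h.1
    simp only [Set.mem_preimage, latticePoint_add_right hκ₁ k s hy.le, Set.mem_singleton_iff,
      Prod.mk.injEq] at h1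
    omega
  · intro s
    simp only [mul_zero]
    refine Set.indicator_of_notMem (fun h ↦ ?_) _
    have h1 := h.1
    have h2 := latticePoint_add_left (r := r) (κ₁ := κ₁) (u := u) hκ₂ k s le_rfl
    simp only [add_zero, zero_div, Nat.ceil_zero] at h2
    simp only [Set.mem_preimage, h2, Set.mem_singleton_iff, Prod.mk.injEq] at h1
    omega

/-- Rounding the excess up sends every positive excess to at least `1`, so a diagonal lattice point
receives mass only from the singular part of the intensity. Rounding down would mix in off-diagonal
mass. -/
lemma intensityMeasure_cell_eq (hγ : 0 < γ) (hδ : 0 < δ) (hr : 0 < r) (hκ₁ : 0 < κ₁)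
    (hκ₂ : 0 < κ₂) (u : ℝ) (k m : ℕ) :
    intensityMeasure γ δ (latticePoint r κ₁ κ₂ u k ⁻¹' {(k + m, k + m)} ∩ quadrant u) =
      ENNReal.ofReal (Real.exp (-u) * (Real.exp (-r) ^ m * (1 - Real.exp (-r))) *
        (1 / (1 + γ + δ))) := by
  have hS := measurableSet_cell r κ₁ κ₂ u k (k + m, k + m)
  have hr1 : Real.exp (-r) ≤ 1 := Real.exp_le_one_iff.2 (by linarith)
  rw [← lintegral_indicator_one hS, lintegral_intensityMeasure_of_factor hγ hδ
    (measurable_one.indicator hS) (measurable_indicator_floor r u m) (g₁ := 0) (g₂ := 0) (c := 1)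
    measurable_zero measurable_zero]
  · rw [lintegral_floor_eq hr]
    simp only [Pi.zero_apply, zero_mul, lintegral_zero, mul_zero, zero_add, mul_one]
    rw [← ENNReal.ofReal_mul]
    exact mul_nonneg (Real.exp_pos _).le (mul_nonneg (by positivity) (by linarith))
  · intro s y hy
    simp only [Pi.zero_apply, mul_zero]
    refine Set.indicator_of_notMem (fun h ↦ ?_) _
    have h1 := h.1
    have h2 := Nat.ceil_pos.2 (div_pos hy hκ₁)
    simp only [Set.mem_preimage, latticePoint_add_left hκ₂ k s hy.le, Set.mem_singleton_iff,
      Prod.mk.injEq] at h1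
    omega
  · intro s y hy
    simp only [Pi.zero_apply, mul_zero]
    refine Set.indicator_of_notMem (fun h ↦ ?_) _
    have h1 := h.1
    have h2 := Nat.ceil_pos.2 (div_pos hy hκ₂)
    simp only [Set.mem_preimage, latticePoint_add_right hκ₁ k s hy.le, Set.mem_singleton_iff,
      Prod.mk.injEq] at h1
    omega
  · intro s
    have h2 := latticePoint_add_left (r := r) (κ₁ := κ₁) (u := u) hκ₂ k s le_rfl
    simp only [add_zero, zero_div, Nat.ceil_zero] at h2
    rw [indicator_eq_mul (A := {s : ℝ | u ≤ s ∧ ⌊(s - u) / r⌋₊ = m}) (B := (Set.univ : Set ℕ))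
      (y := s) (z := 0)]
    · simp
    · simp only [Set.mem_inter_iff, Set.mem_preimage, h2, Set.mem_singleton_iff, Prod.mk.injEq,
        mk_mem_quadrant, and_self, Set.mem_ofPred_eq, Set.mem_univ, and_true]
      constructor
      · rintro ⟨h3, h4⟩
        exact ⟨h4, by omega⟩
      · rintro ⟨h3, h4⟩
        exact ⟨by omega, h3⟩

end Cells

lemma geometricLaw_singleton (q₁ q₂ p₀₀ : ℝ) (x : ℕ × ℕ) :
    geometricLaw q₁ q₂ p₀₀ {x} = ENNReal.ofReal (geometricPMF q₁ q₂ p₀₀ x) :=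
  Measure.sum_smul_dirac_singleton

/-- The lattice point next to a point with the limiting exponential distribution has the
Marshall-Olkin geometric distribution. -/
theorem smul_map_latticePoint {γ δ p₁₁ q₁ q₂ p₀₀ r κ₁ κ₂ : ℝ} (hγ : 0 < γ) (hδ : 0 < δ)
    (hq₁ : q₁ = 1 - (1 + γ) * p₁₁) (hq₂ : q₂ = 1 - (1 + δ) * p₁₁)
    (hp₀₀ : p₀₀ = 1 - (1 + γ + δ) * p₁₁) (hr : 0 < r) (hκ₁ : 0 < κ₁) (hκ₂ : 0 < κ₂)
    (er : Real.exp (-r) = p₀₀) (e₁ : Real.exp (-((1 + γ) / (1 + γ + δ) * κ₁)) = q₁)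
    (e₂ : Real.exp (-((1 + δ) / (1 + γ + δ) * κ₂)) = q₂) (u : ℝ) (k : ℕ) :
    ENNReal.ofReal (p₀₀ ^ k) •
        ((intensityMeasure γ δ).restrict (quadrant u)).map (latticePoint r κ₁ κ₂ u k) =
      ENNReal.ofReal (Real.exp (-u)) •
        (geometricLaw q₁ q₂ p₀₀).restrict {x | k ≤ x.1 ∧ k ≤ x.2} := by
  have hM : 0 < 1 + γ + δ := by positivity
  have p0 : 0 < p₀₀ := er ▸ Real.exp_pos _
  have q10 : 0 < q₁ := e₁ ▸ Real.exp_pos _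
  have q20 : 0 < q₂ := e₂ ▸ Real.exp_pos _
  refine Measure.ext_of_singleton fun x ↦ ?_
  rw [Measure.smul_apply, Measure.smul_apply, Measure.map_apply (measurable_latticePoint _ _ _ _ _)
    (measurableSet_singleton x), Measure.restrict_apply (measurable_latticePoint _ _ _ _ _
    (measurableSet_singleton x)), Measure.restrict_apply (measurableSet_singleton x), smul_eq_mul,
    smul_eq_mul]
  by_cases hx : k ≤ x.1 ∧ k ≤ x.2
  · rw [Set.inter_eq_left.2 (show {x} ⊆ {x : ℕ × ℕ | k ≤ x.1 ∧ k ≤ x.2} from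
      Set.singleton_subset_iff.2 hx), geometricLaw_singleton,
      ← ENNReal.ofReal_mul (Real.exp_pos _).le]
    obtain ⟨a, b⟩ := x
    obtain ⟨h1, h2⟩ := hx
    simp only at h1 h2
    rcases lt_trichotomy a b with h | h | h
    · obtain ⟨m, rfl⟩ := Nat.exists_eq_add_of_le h1
      obtain ⟨j, rfl⟩ := Nat.exists_eq_add_of_lt h
      rw [add_assoc (k + m) j 1, intensityMeasure_cell_lt hγ hδ hr hκ₁ hκ₂, er, e₂,
        ← ENNReal.ofReal_mul (by positivity)]
      congr 1
      have e : k + m + (j + 1) - (k + m) = j + 1 := by omega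
      simp only [geometricPMF, if_pos (show k + m < k + m + (j + 1) by omega), e]
      -- `e3` factors the point probability, and `e4` evaluates the weight of this side: `(1 - p₀₀)
      -- γ / (1 + γ + δ) = γ p₁₁ = q₂ - p₀₀`.
      have e3 : q₂ ^ (j + 1) * (1 - p₀₀ / q₂ - q₂ + p₀₀) = q₂ ^ j * ((q₂ - p₀₀) * (1 - q₂)) := by
        field_simp
        ring
      have e4 : (1 - p₀₀) * (γ * (1 + δ) / (1 + γ + δ) ^ 2 / ((1 + δ) / (1 + γ + δ))) =
          q₂ - p₀₀ := by
        rw [hp₀₀, hq₂]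
        field_simp
        ring
      rw [mul_assoc (p₀₀ ^ (k + m)), e3, ← e4, pow_add]
      ring
    · subst h
      obtain ⟨m, rfl⟩ := Nat.exists_eq_add_of_le h1
      rw [intensityMeasure_cell_eq hγ hδ hr hκ₁ hκ₂, er, ← ENNReal.ofReal_mul (by positivity)]
      congr 1
      simp only [geometricPMF, lt_irrefl, if_false, if_true]
      -- Both sides equal `p₁₁`.
      have e4 : (1 - p₀₀) * (1 / (1 + γ + δ)) = 1 - q₁ - q₂ + p₀₀ := by
        rw [hp₀₀, hq₂, hq₁]
        field_simp
        ring
      rw [← e4, pow_add]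
      ring
    · obtain ⟨m, rfl⟩ := Nat.exists_eq_add_of_le h2
      obtain ⟨j, rfl⟩ := Nat.exists_eq_add_of_lt h
      rw [add_assoc (k + m) j 1, intensityMeasure_cell_gt hγ hδ hr hκ₁ hκ₂, er, e₁,
        ← ENNReal.ofReal_mul (by positivity)]
      congr 1
      have e : k + m + (j + 1) - (k + m) = j + 1 := by omega
      simp only [geometricPMF, if_neg (show ¬ k + m + (j + 1) < k + m by omega),
        if_neg (show ¬ k + m + (j + 1) = k + m by omega), e]
      have e3 : q₁ ^ (j + 1) * (1 - q₁ - p₀₀ / q₁ + p₀₀) = q₁ ^ j * ((q₁ - p₀₀) * (1 - q₁)) := by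
        field_simp
        ring
      have e4 : (1 - p₀₀) * (δ * (1 + γ) / (1 + γ + δ) ^ 2 / ((1 + γ) / (1 + γ + δ))) =
          q₁ - p₀₀ := by
        rw [hp₀₀, hq₁]
        field_simp
        ring
      rw [mul_assoc (p₀₀ ^ (k + m)), e3, ← e4, pow_add]
      ring
  -- Rounding never produces a coordinate below `k`, so both measures vanish at `x`.
  · have h1 : latticePoint r κ₁ κ₂ u k ⁻¹' {x} ∩ quadrant u = ∅ := by
      refine Set.eq_empty_of_forall_notMem fun z hz ↦ hx ?_
      have := hz.1
      simp only [Set.mem_preimage, Set.mem_singleton_iff] at this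
      rw [← this]
      simp only [latticePoint]
      omega
    have h2 : {x} ∩ {x : ℕ × ℕ | k ≤ x.1 ∧ k ≤ x.2} = ∅ := by
      refine Set.eq_empty_of_forall_notMem fun z hz ↦ hx ?_
      rw [← Set.mem_singleton_iff.1 hz.1]
      exact hz.2
    rw [h1, h2]
    simp

/-! ### Total mass and mean excess of the limit measure. -/

section Moments

variable {γ δ : ℝ}

lemma lintegral_indicator_Ici_exp (u : ℝ) :
    ∫⁻ s, (Set.Ici u).indicator 1 s * ENNReal.ofReal (Real.exp (-s)) =
      ENNReal.ofReal (Real.exp (-u)) := by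
  have e : ∀ s, (Set.Ici u).indicator 1 s * ENNReal.ofReal (Real.exp (-s)) =
      (Set.Ici u).indicator (fun s ↦ ENNReal.ofReal (Real.exp (-(1 * s)))) s := fun s ↦ by
    by_cases hs : s ∈ Set.Ici u
    · rw [Set.indicator_of_mem hs, Set.indicator_of_mem hs]; simp
    · rw [Set.indicator_of_notMem hs, Set.indicator_of_notMem hs]; simp
  simp_rw [e]
  rw [lintegral_indicator measurableSet_Ici, setLIntegral_congr Ioi_ae_eq_Ici.symm,
    setLIntegral_exp_neg_Ioi one_pos]
  simp

lemma indicator_quadrant_mul {u s : ℝ} {z : Plane} (h : z ∈ quadrant u ↔ u ≤ s) {a b : ℝ≥0∞}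
    (hab : a = b) : (quadrant u).indicator 1 z * a = (Set.Ici u).indicator 1 s * b := by
  subst hab
  by_cases hs : u ≤ s
  · rw [Set.indicator_of_mem (h.2 hs), Set.indicator_of_mem (by exact hs)]
    simp
  · rw [Set.indicator_of_notMem (fun h' ↦ hs (h.1 h')), Set.indicator_of_notMem (by exact hs)]

lemma lintegral_limitMeanMeasure (u : ℝ) (F : Plane → ℝ≥0∞) :
    ∫⁻ z : quadrant u, F z ∂(limitMeanMeasure γ δ u) =
      ∫⁻ z, (quadrant u).indicator 1 z * F z ∂(intensityMeasure γ δ) := by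
  rw [limitMeanMeasure, lintegral_subtype_comap (measurableSet_quadrant u),
    ← lintegral_indicator (measurableSet_quadrant u)]
  refine lintegral_congr fun z ↦ ?_
  by_cases hz : z ∈ quadrant u <;> simp [hz]

/-- The two sides and the diagonal have the weights `γ`, `δ` and `1`, each divided by `1 + γ + δ`,
so only the mass of the smaller coordinate remains. -/
lemma limitMeanMeasure_univ (hγ : 0 < γ) (hδ : 0 < δ) (u : ℝ) :
    limitMeanMeasure γ δ u Set.univ = ENNReal.ofReal (Real.exp (-u)) := by
  have hI : Measurable ((Set.Ici u).indicator (1 : ℝ → ℝ≥0∞)) :=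
    measurable_one.indicator measurableSet_Ici
  have hm : Measurable fun z : Plane ↦ (quadrant u).indicator (1 : Plane → ℝ≥0∞) z * 1 :=
    (measurable_one.indicator (measurableSet_quadrant u)).mul measurable_const
  rw [← lintegral_one, lintegral_limitMeanMeasure u fun _ ↦ 1,
    lintegral_intensityMeasure_of_factor hγ hδ hm hI (g₁ := fun _ ↦ 1) (g₂ := fun _ ↦ 1) (c := 1) measurable_const measurable_const]
  · simp only [one_mul, mul_one]
    rw [lintegral_indicator_Ici_exp, setLIntegral_exp_neg_Ioi (by positivity),
      setLIntegral_exp_neg_Ioi (by positivity), ← ENNReal.ofReal_mul (by positivity),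
      ← ENNReal.ofReal_mul (by positivity), ← ENNReal.ofReal_add (by positivity) (by positivity),
      ← ENNReal.ofReal_add (by positivity) (by positivity), ← ENNReal.ofReal_mul (by positivity)]
    congr 1
    simp only [mul_zero, neg_zero, Real.exp_zero]
    field_simp
    ring
  · exact fun s y hy ↦ indicator_quadrant_mul (add_left_mem_quadrant hy.le) rfl
  · exact fun s y hy ↦ indicator_quadrant_mul (add_right_mem_quadrant hy.le) rfl
  · exact fun s ↦ indicator_quadrant_mul (by simp [mk_mem_quadrant]) rfl

/-- On each side `|z 0 - z 1|` is the excess, whose exponential first moment is the reciprocal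
square of the rate. This controls the error of rescaling the excess. -/
lemma lintegral_abs_sub_limitMeanMeasure (hγ : 0 < γ) (hδ : 0 < δ) (u : ℝ) :
    ∫⁻ z : quadrant u, ENNReal.ofReal |z.1 0 - z.1 1| ∂(limitMeanMeasure γ δ u) =
      ENNReal.ofReal (Real.exp (-u) * (γ / (1 + δ) + δ / (1 + γ))) := by
  have hI : Measurable ((Set.Ici u).indicator (1 : ℝ → ℝ≥0∞)) :=
    measurable_one.indicator measurableSet_Ici
  have hd : Measurable fun z : Plane ↦ ENNReal.ofReal |z 0 - z 1| := by
    have h0 := measurable_coord 0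
    have h1 := measurable_coord 1
    fun_prop
  have hm : Measurable fun z : Plane ↦
      (quadrant u).indicator (1 : Plane → ℝ≥0∞) z * ENNReal.ofReal |z 0 - z 1| :=
    (measurable_one.indicator (measurableSet_quadrant u)).mul hd
  rw [lintegral_limitMeanMeasure u fun z ↦ ENNReal.ofReal |z 0 - z 1|,
    lintegral_intensityMeasure_of_factor hγ hδ hm hI (g₁ := ENNReal.ofReal) (g₂ := ENNReal.ofReal) (c := 0) (by fun_prop) (by fun_prop)]
  · rw [lintegral_indicator_Ici_exp, setLIntegral_mul_exp_neg_Ioi (by positivity),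
      setLIntegral_mul_exp_neg_Ioi (by positivity), mul_zero, add_zero,
      ← ENNReal.ofReal_mul (by positivity),
      ← ENNReal.ofReal_mul (by positivity), ← ENNReal.ofReal_add (by positivity) (by positivity),
      ← ENNReal.ofReal_mul (by positivity)]
    congr 1
    field_simp
  · refine fun s y hy ↦ indicator_quadrant_mul (add_left_mem_quadrant hy.le) ?_
    change ENNReal.ofReal |s + y - s| = _
    rw [add_sub_cancel_left, abs_of_pos hy]
  · refine fun s y hy ↦ indicator_quadrant_mul (add_right_mem_quadrant hy.le) ?_
    change ENNReal.ofReal |s - (s + y)| = _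
    rw [sub_add_cancel_left, abs_neg, abs_of_pos hy]
  · refine fun s ↦ indicator_quadrant_mul (by simp [mk_mem_quadrant]) ?_
    change ENNReal.ofReal |s - s| = _
    simp

end Moments

end MarshallOlkin

/-! ### The displacement caused by rounding, and the final constants. -/

namespace MarshallOlkin

lemma le_neg_log_one_sub {x : ℝ} (hx : x < 1) : x ≤ -Real.log (1 - x) := by
  linarith [Real.log_le_sub_one_of_pos (sub_pos.2 hx)]

lemma neg_log_one_sub_le {x : ℝ} (hx : x < 1) : -Real.log (1 - x) ≤ x / (1 - x) := by
  have h := Real.one_sub_inv_le_log_of_pos (sub_pos.2 hx)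
  have h1 : (1 - x) ≠ 0 := (sub_pos.2 hx).ne'
  have e : x / (1 - x) = (1 - x)⁻¹ - 1 := by field_simp; ring
  linarith

/-- The logarithms of `1 - x` and `1 - t x` are nearly proportional to `1` and `t`. -/
lemma abs_log_ratio_sub_one_le {x t : ℝ} (hx0 : 0 < x) (hx1 : x < 1) (ht0 : 0 < t) (ht1 : t ≤ 1) :
    |-Real.log (1 - x) / (-Real.log (1 - t * x) / t) - 1| ≤ x / (1 - x) := by
  have htx : t * x ≤ x := mul_le_of_le_one_left hx0.le ht1
  have htx0 : 0 < t * x := by positivity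
  have hx' : 0 < 1 - x := sub_pos.2 hx1
  have r1 := le_neg_log_one_sub hx1
  have r2 := neg_log_one_sub_le hx1
  have s1 := le_neg_log_one_sub (htx.trans_lt hx1)
  have s2 := neg_log_one_sub_le (htx.trans_lt hx1)
  set r := -Real.log (1 - x)
  set s := -Real.log (1 - t * x)
  have hs : 0 < s := htx0.trans_le s1
  rw [le_div_iff₀ (by linarith)] at s2
  rw [le_div_iff₀ hx'] at r2
  have e : r / (s / t) - 1 = (r * t - s) / s := by field_simp
  rw [e, abs_div, abs_of_pos hs, div_le_div_iff₀ hs hx', ← abs_of_pos hx', ← abs_mul, abs_le]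
  -- Both `r * t` and `s` lie between `t x` and `t x / (1 - x)`, so their ratio is within `x / (1 -
  -- x)` of `1`.
  have hsx : 0 ≤ s * (x - t * x) := mul_nonneg hs.le (by linarith)
  have hst : s * (1 - x) ≤ t * x := by nlinarith
  have hrt : t * x ≤ r * t := by nlinarith
  have hrt2 : r * t * (1 - x) ≤ x * t := by nlinarith
  constructor
  · have : s * (1 - x) * (1 - x) ≤ r * t * (1 - x) :=
      mul_le_mul_of_nonneg_right (hst.trans hrt) hx'.le
    nlinarith [mul_nonneg hs.le (sq_nonneg x)]
  · nlinarith

/-- Rounding up costs at most one step `r`; replacing the unit `κ` by `r` costs at most `ε y`. -/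
lemma abs_mul_ceil_sub_le {r κ ε y : ℝ} (hr : 0 < r) (hκ : 0 < κ) (hε : |r / κ - 1| ≤ ε)
    (hy : 0 ≤ y) : |r * ⌈y / κ⌉₊ - y| ≤ r + ε * y := by
  have h1 := Nat.le_ceil (y / κ)
  have h2 := (Nat.ceil_lt_add_one (div_nonneg hy hκ.le)).le
  have e : r * (y / κ) = y * (r / κ) := by ring
  have h1' := mul_le_mul_of_nonneg_left h1 hr.le
  have h2' := mul_le_mul_of_nonneg_left h2 hr.le
  obtain ⟨h3, h4⟩ := abs_le.1 hε
  have h3' := mul_le_mul_of_nonneg_left h3 hy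
  have h4' := mul_le_mul_of_nonneg_left h4 hy
  rw [abs_le]
  constructor <;> linarith

lemma dist_le_abs_add_abs (z w : Plane) : dist z w ≤ |z 0 - w 0| + |z 1 - w 1| := by
  rw [EuclideanSpace.dist_eq, Fin.sum_univ_two, Real.dist_eq, Real.dist_eq]
  refine Real.sqrt_le_iff.2 ⟨by positivity, ?_⟩
  nlinarith [mul_nonneg (abs_nonneg (z 0 - w 0)) (abs_nonneg (z 1 - w 1))]

/-- The smaller coordinate moves by at most `r`: starting the lattice at `k` shifts it up by at most
`r`, and rounding shifts it down by at most `r`. The larger coordinate inherits this and adds the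
error of its excess, for at most `2 r + ε |z 0 - z 1|`. -/
lemma dist_normalise_latticePoint_le {n : ℕ} {p₀₀ κ₁ κ₂ ε u : ℝ} {k : ℕ}
    (hr : 0 < Real.log (1 / p₀₀)) (hκ₁ : 0 < κ₁) (hκ₂ : 0 < κ₂)
    (h₁ : |Real.log (1 / p₀₀) / κ₁ - 1| ≤ ε) (h₂ : |Real.log (1 / p₀₀) / κ₂ - 1| ≤ ε)
    (hk₁ : u + Real.log n ≤ k * Real.log (1 / p₀₀))
    (hk₂ : k * Real.log (1 / p₀₀) ≤ u + Real.log n + Real.log (1 / p₀₀))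
    {z : Plane} (hz : z ∈ quadrant u) :
    dist (normalise n p₀₀ (latticePoint (Real.log (1 / p₀₀)) κ₁ κ₂ u k z)) z ≤
      3 * Real.log (1 / p₀₀) + ε * |z 0 - z 1| := by
  set r := Real.log (1 / p₀₀) with hr_def
  obtain ⟨hz0, hz1⟩ := hz
  refine (dist_le_abs_add_abs _ _).trans ?_
  change |(latticePoint r κ₁ κ₂ u k z).1 * r - Real.log n - z 0| +
    |(latticePoint r κ₁ κ₂ u k z).2 * r - Real.log n - z 1| ≤ _
  simp only [latticePoint]
  have hs : 0 ≤ (min (z 0) (z 1) - u) / r := div_nonneg (sub_nonneg.2 (le_min hz0 hz1)) hr.le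
  have hm1 := Nat.floor_le hs
  have hm2 := (Nat.lt_floor_add_one ((min (z 0) (z 1) - u) / r)).le
  rw [le_div_iff₀ hr] at hm1
  rw [div_le_iff₀ hr] at hm2
  push_cast
  set m : ℝ := (⌊(min (z 0) (z 1) - u) / r⌋₊ : ℝ)
  rcases le_total (z 0) (z 1) with h | h
  · have hc : ⌈(z 0 - z 1) / κ₁⌉₊ = 0 :=
      Nat.ceil_eq_zero.2 (div_nonpos_of_nonpos_of_nonneg (by linarith) hκ₁.le)
    have hb := abs_mul_ceil_sub_le hr hκ₂ h₂ (sub_nonneg.2 h)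
    rw [min_eq_left h] at hm1 hm2
    rw [hc, abs_of_nonpos (sub_nonpos.2 h), neg_sub]
    rw [abs_le] at hb
    have a1 : |((k : ℝ) + m + ((0 : ℕ) : ℝ)) * r - Real.log n - z 0| ≤ r := by
      rw [abs_le]; push_cast; constructor <;> linarith
    have a2 : |((k : ℝ) + m + (⌈(z 1 - z 0) / κ₂⌉₊ : ℝ)) * r - Real.log n - z 1| ≤
        2 * r + ε * (z 1 - z 0) := by
      rw [abs_le]; constructor <;> linarith
    exact (add_le_add a1 a2).trans (by linarith)
  · have hc : ⌈(z 1 - z 0) / κ₂⌉₊ = 0 :=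
      Nat.ceil_eq_zero.2 (div_nonpos_of_nonpos_of_nonneg (by linarith) hκ₂.le)
    have hb := abs_mul_ceil_sub_le hr hκ₁ h₁ (sub_nonneg.2 h)
    rw [min_eq_right h] at hm1 hm2
    rw [hc, abs_of_nonneg (sub_nonneg.2 h)]
    rw [abs_le] at hb
    have a1 : |((k : ℝ) + m + ((0 : ℕ) : ℝ)) * r - Real.log n - z 1| ≤ r := by
      rw [abs_le]; push_cast; constructor <;> linarith
    have a2 : |((k : ℝ) + m + (⌈(z 0 - z 1) / κ₁⌉₊ : ℝ)) * r - Real.log n - z 0| ≤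
        2 * r + ε * (z 0 - z 1) := by
      rw [abs_le]; constructor <;> linarith
    exact (add_le_add a2 a1).trans (by linarith)

lemma latticePoint_normalise_mem {n : ℕ} {p₀₀ r κ₁ κ₂ u : ℝ} {k : ℕ}
    (hr : 0 < Real.log (1 / p₀₀)) (hk : u + Real.log n ≤ k * Real.log (1 / p₀₀)) (z : Plane) :
    normalise n p₀₀ (latticePoint r κ₁ κ₂ u k z) ∈ quadrant u := by
  have h : ∀ a : ℕ, k ≤ a → u ≤ a * Real.log (1 / p₀₀) - Real.log n := fun a ha ↦ by
    have : (k : ℝ) * Real.log (1 / p₀₀) ≤ a * Real.log (1 / p₀₀) :=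
      mul_le_mul_of_nonneg_right (by exact_mod_cast ha) hr.le
    linarith
  exact ⟨h _ (by simp only [latticePoint]; omega), h _ (by simp only [latticePoint]; omega)⟩

/-- The converse of `latticePoint_normalise_mem` for this starting index: no lattice point of the
quadrant is missed by the rounding map. -/
lemma le_of_normalise_mem {n : ℕ} {p₀₀ u : ℝ} {x : ℕ × ℕ} (hr : 0 < Real.log (1 / p₀₀))
    (hx : normalise n p₀₀ x ∈ quadrant u) :
    ⌈(u + Real.log n) / Real.log (1 / p₀₀)⌉₊ ≤ x.1 ∧
      ⌈(u + Real.log n) / Real.log (1 / p₀₀)⌉₊ ≤ x.2 := by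
  have h0 : u ≤ x.1 * Real.log (1 / p₀₀) - Real.log n := hx.1
  have h1 : u ≤ x.2 * Real.log (1 / p₀₀) - Real.log n := hx.2
  rw [Nat.ceil_le, Nat.ceil_le, div_le_iff₀ hr, div_le_iff₀ hr]
  constructor <;> linarith

open PointProcess in
lemma map_exceedanceProcess {Ω : Type*} [MeasurableSpace Ω] {P : Measure Ω}
    [IsProbabilityMeasure P] {n : ℕ} {L : Measure (ℕ × ℕ)} [IsProbabilityMeasure L] (p₀₀ u : ℝ)
    {X : Fin n → Ω → ℕ × ℕ} (hX_law : ∀ i, HasLaw (X i) L P) (hX_indep : iIndepFun X P) :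
    P.map (exceedanceProcess n p₀₀ u X) =
      (Measure.pi fun _ : Fin n ↦ L.map (normalise n p₀₀)).map (configIn (quadrant u)) := by
  have hN : Measurable (normalise n p₀₀) := .of_discrete
  have hμprob : IsProbabilityMeasure (L.map (normalise n p₀₀)) :=
    Measure.isProbabilityMeasure_map hN.aemeasurable
  have hXm : ∀ i, AEMeasurable (X i) P := fun i ↦ (hX_law i).aemeasurable
  have hpi := (iIndepFun_iff_map_fun_eq_pi_map hXm).1 hX_indep
  simp_rw [fun i ↦ (hX_law i).map_eq] at hpi
  have hNn : Measurable fun (y : Fin n → ℕ × ℕ) i ↦ normalise n p₀₀ (y i) :=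
    measurable_pi_lambda _ fun i ↦ hN.comp (measurable_pi_apply i)
  have hcm := measurable_configIn (measurableSet_quadrant u) n
  rw [← Measure.pi_map_pi fun _ ↦ hN.aemeasurable, ← hpi, Measure.map_map hcm hNn,
    AEMeasurable.map_map_of_aemeasurable (hcm.comp hNn).aemeasurable
      (aemeasurable_pi_lambda _ hXm)]
  rfl

lemma ofReal_exp_neg_mul_ofReal_exp (u : ℝ) :
    ENNReal.ofReal (Real.exp (-u)) * ENNReal.ofReal (Real.exp u) = 1 := by
  rw [← ENNReal.ofReal_mul (Real.exp_pos _).le, ← Real.exp_add]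
  simp

lemma integral_abs_sub_limitMeanMeasure {γ δ : ℝ} (hγ : 0 < γ) (hδ : 0 < δ) (u : ℝ) :
    Integrable (fun z : quadrant u ↦ |z.1 0 - z.1 1|)
        (ENNReal.ofReal (Real.exp u) • limitMeanMeasure γ δ u) ∧
      ∫ z : quadrant u, |z.1 0 - z.1 1| ∂(ENNReal.ofReal (Real.exp u) • limitMeanMeasure γ δ u) =
        γ / (1 + δ) + δ / (1 + γ) := by
  set ν := ENNReal.ofReal (Real.exp u) • limitMeanMeasure γ δ u with hν
  have hD : Measurable fun z : quadrant u ↦ |z.1 0 - z.1 1| := by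
    have h0 := (measurable_coord 0).comp (measurable_subtype_coe (p := (· ∈ quadrant u)))
    have h1 := (measurable_coord 1).comp (measurable_subtype_coe (p := (· ∈ quadrant u)))
    exact (h0.sub h1).abs
  have hDl : ∫⁻ z : quadrant u, ENNReal.ofReal |z.1 0 - z.1 1| ∂ν =
      ENNReal.ofReal (γ / (1 + δ) + δ / (1 + γ)) := by
    rw [hν, lintegral_smul_measure, lintegral_abs_sub_limitMeanMeasure hγ hδ,
      ENNReal.ofReal_mul (Real.exp_pos _).le, smul_eq_mul, ← mul_assoc, mul_comm
      (ENNReal.ofReal (Real.exp u)), ofReal_exp_neg_mul_ofReal_exp, one_mul]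
  have hDi : Integrable (fun z : quadrant u ↦ |z.1 0 - z.1 1|) ν :=
    (lintegral_ofReal_ne_top_iff_integrable hD.aestronglyMeasurable
      (Filter.Eventually.of_forall fun z ↦ abs_nonneg _)).1 (hDl ▸ ENNReal.ofReal_ne_top)
  have hDe : ∫ z : quadrant u, |z.1 0 - z.1 1| ∂ν = γ / (1 + δ) + δ / (1 + γ) := by
    rw [integral_eq_lintegral_of_nonneg_ae (Filter.Eventually.of_forall fun z ↦ abs_nonneg _)
      hD.aestronglyMeasurable, hDl, ENNReal.toReal_ofReal (by positivity)]
  exact ⟨hDi, hDe⟩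

/-- Everything is compared with `c = (1 + γ + δ)² p₁₁ / (1 - x)³`, which dominates `x`, `x / (1 -
x)` and `(1 + γ + δ) x / (1 - x)`. In the application `a = p₀₀ ^ k`, and `W` is the mean
displacement. -/
lemma sum_bounds_le {γ δ p₁₁ p₀₀ b a N W u : ℝ} (hγ : 0 < γ) (hδ : 0 < δ) (hp0 : 0 < p₁₁)
    (hx1 : (1 + γ + δ) * p₁₁ < 1) (hb : b = Real.exp (-u))
    (hp₀₀ : p₀₀ = 1 - (1 + γ + δ) * p₁₁) (hpb : a ≤ b / N)
    (hab' : p₀₀ * b ≤ N * a) (hW0 : 0 ≤ W)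
    (hW : W ≤ 4 * ((1 + γ + δ) * ((1 + γ + δ) * p₁₁ / (1 - (1 + γ + δ) * p₁₁)))) :
    a + min (b - N * a) (√b - √(N * a)) + min b 1 * W ≤
      b / N + (1 + γ + δ) ^ 2 * p₁₁ / (1 - (1 + γ + δ) * p₁₁) ^ 3 *
          (2 * √2 + 7 * min b (1.65 * Real.exp (-u / 2))) := by
  have hb0 : 0 < b := hb ▸ Real.exp_pos _
  have hsq : Real.exp (-u / 2) = √b := by rw [hb, ← Real.exp_half]
  rw [hsq]
  set x := (1 + γ + δ) * p₁₁ with hx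
  have hM : 0 < 1 + γ + δ := by positivity
  have hx0 : 0 < x := by positivity
  set c := (1 + γ + δ) ^ 2 * p₁₁ / (1 - x) ^ 3 with hc
  set m := min b (1.65 * √b) with hm
  have h1x : 0 < 1 - x := by linarith
  have hε0 : 0 ≤ x / (1 - x) := by positivity
  have hcx : (1 + γ + δ) * (x / (1 - x)) ≤ c := by
    have e : c = (1 + γ + δ) * x / (1 - x) ^ 3 := by rw [hc, hx]; ring
    rw [e, ← mul_div_assoc]
    refine div_le_div_of_nonneg_left (by positivity) (by positivity) ?_
    exact pow_le_of_le_one h1x.le (by linarith) (by norm_num)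
  have hxε : x ≤ x / (1 - x) := le_div_self hx0.le h1x (by linarith)
  have hεc : x / (1 - x) ≤ c := (le_mul_of_one_le_left hε0 (by linarith)).trans hcx
  have hxc : x ≤ c := hxε.trans hεc
  have hc0 : 0 ≤ c := hx0.le.trans hxc
  have hWc : W ≤ 4 * c := hW.trans (by linarith)
  have hsb : 0 < √b := Real.sqrt_pos.2 hb0
  have hbb : √b * √b = b := Real.mul_self_sqrt hb0.le
  -- This rests on `min b 1 ≤ √b`.
  have hm1 : min b 1 ≤ m := by
    refine le_min (min_le_left _ _) ?_
    rcases le_total b 1 with h | h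
    · rw [min_eq_left h]
      have : √b ≤ 1 := Real.sqrt_le_one.2 h
      have := mul_le_of_le_one_left hsb.le this
      linarith
    · rw [min_eq_right h]
      have : 1 ≤ √b := Real.one_le_sqrt.2 h
      linarith
  have hm2 : min (b - N * a) (√b - √(N * a)) ≤ c * m := by
    -- Here `p₀₀² ≤ p₀₀` suffices, so the difference of the roots is at most `x √b`.
    have hs : p₀₀ * √b ≤ √(N * a) := by
      refine Real.le_sqrt_of_sq_le ?_
      rw [mul_pow, Real.sq_sqrt hb0.le]
      refine le_trans (mul_le_mul_of_nonneg_right ?_ hb0.le) hab'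
      exact pow_le_of_le_one (by linarith) (by linarith) two_ne_zero
    have t1 : b - N * a ≤ c * b := by
      have : b - N * a ≤ x * b := by rw [hp₀₀] at hab'; linarith
      exact this.trans (mul_le_mul_of_nonneg_right hxc hb0.le)
    have t2 : √b - √(N * a) ≤ c * (1.65 * √b) := by
      have e : p₀₀ * √b = √b - x * √b := by rw [hp₀₀]; ring
      have h1 := mul_le_mul_of_nonneg_right hxc hsb.le
      have h2 := mul_nonneg hc0 hsb.le
      linarith
    rcases min_choice b (1.65 * √b) with h | h
    · rw [hm, h]; exact (min_le_left _ _).trans t1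
    · rw [hm, h]; exact (min_le_right _ _).trans t2
  have hm0 : 0 ≤ m := le_min hb0.le (by positivity)
  -- The change of the mean costs `c m` and the displacement `4 c m`, so `5 c m` is enough; the term
  -- with `2 √2` is slack.
  have h3 : min b 1 * W ≤ m * (4 * c) := mul_le_mul hm1 hWc hW0 hm0
  have h4 : 0 ≤ c * (2 * √2) := by positivity
  have h5 : 0 ≤ c * m := by positivity
  rw [mul_add]
  linarith

end MarshallOlkin

/-! ### The approximation theorem. -/

open MarshallOlkin PointProcess in
theorem corollaryt {Ω : Type*} [MeasurableSpace Ω] (P : Measure Ω) [IsProbabilityMeasure P]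
    (n : ℕ) (hn : 1 ≤ n)
    (γ δ p₁₁ q₁ q₂ p₀₀ : ℝ) (hγ : 0 < γ) (hδ : 0 < δ) (hp₁₁ : p₁₁ ∈ Set.Ioo (0 : ℝ) 1)
    (hq₁ : q₁ = 1 - (1 + γ) * p₁₁) (hq₂ : q₂ = 1 - (1 + δ) * p₁₁)
    (hp₀₀ : p₀₀ = 1 - (1 + γ + δ) * p₁₁) (hp₀₀_pos : 0 < p₀₀)
    (X : Fin n → Ω → ℕ × ℕ)
    (hX_law : ∀ i, HasLaw (X i) (MarshallOlkin.geometricLaw q₁ q₂ p₀₀) P)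
    (hX_indep : iIndepFun X P)
    (u : ℝ) (hu : -Real.log n ≤ u) :
    PointProcess.d2 (P.map (MarshallOlkin.exceedanceProcess n p₀₀ u X))
        (PointProcess.PRM (MarshallOlkin.limitMeanMeasure γ δ u)) ≤
      Real.exp (-u) / n +
        (1 + γ + δ) ^ 2 * p₁₁ / (1 - (1 + γ + δ) * p₁₁) ^ 3 *
          (2 * √2 + 7 * min (Real.exp (-u)) (1.65 * Real.exp (-u / 2))) := by
  obtain ⟨hp0, hp1⟩ := hp₁₁
  have hM : 0 < 1 + γ + δ := by positivity
  have hn0 : (0 : ℝ) < n := by exact_mod_cast hn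
  set x := (1 + γ + δ) * p₁₁ with hx
  have hx0 : 0 < x := by positivity
  have hx1 : x < 1 := by linarith
  have hr_eq : Real.log (1 / p₀₀) = -Real.log (1 - x) := by
    rw [one_div, Real.log_inv, hp₀₀]
  set r := Real.log (1 / p₀₀) with hr_def
  have hr1 : x ≤ r := hr_eq ▸ le_neg_log_one_sub hx1
  have hr2 : r ≤ x / (1 - x) := hr_eq ▸ neg_log_one_sub_le hx1
  have hr : 0 < r := hx0.trans_le hr1
  have er : Real.exp (-r) = p₀₀ := by
    rw [hr_eq, neg_neg, Real.exp_log (by linarith), hp₀₀]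
  set β₁ := (1 + γ) / (1 + γ + δ) with hβ₁
  set β₂ := (1 + δ) / (1 + γ + δ) with hβ₂
  have hβ₁0 : 0 < β₁ := by positivity
  have hβ₂0 : 0 < β₂ := by positivity
  have hβ₁1 : β₁ ≤ 1 := (div_le_one hM).2 (by linarith)
  have hβ₂1 : β₂ ≤ 1 := (div_le_one hM).2 (by linarith)
  have hq₁' : q₁ = 1 - β₁ * x := by rw [hq₁, hβ₁, hx]; field_simp
  have hq₂' : q₂ = 1 - β₂ * x := by rw [hq₂, hβ₂, hx]; field_simp
  have hq₁1 : β₁ * x < 1 := (mul_le_of_le_one_left hx0.le hβ₁1).trans_lt hx1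
  have hq₂1 : β₂ * x < 1 := (mul_le_of_le_one_left hx0.le hβ₂1).trans_lt hx1
  -- The rounding units for the excesses are chosen so that exponential variables with rates `β₁`,
  -- `β₂` become geometric with parameters `q₁`, `q₂`.
  set κ₁ := -Real.log (1 - β₁ * x) / β₁ with hκ₁_def
  set κ₂ := -Real.log (1 - β₂ * x) / β₂ with hκ₂_def
  have hκ₁ : 0 < κ₁ :=
    div_pos ((by positivity : 0 < β₁ * x).trans_le (le_neg_log_one_sub hq₁1)) hβ₁0
  have hκ₂ : 0 < κ₂ :=
    div_pos ((by positivity : 0 < β₂ * x).trans_le (le_neg_log_one_sub hq₂1)) hβ₂0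
  have e₁ : Real.exp (-(β₁ * κ₁)) = q₁ := by
    rw [hκ₁_def, mul_div_cancel₀ _ hβ₁0.ne', neg_neg, Real.exp_log (by linarith), hq₁']
  have e₂ : Real.exp (-(β₂ * κ₂)) = q₂ := by
    rw [hκ₂_def, mul_div_cancel₀ _ hβ₂0.ne', neg_neg, Real.exp_log (by linarith), hq₂']
  have hε₁ : |r / κ₁ - 1| ≤ x / (1 - x) := hr_eq ▸ abs_log_ratio_sub_one_le hx0 hx1 hβ₁0 hβ₁1
  have hε₂ : |r / κ₂ - 1| ≤ x / (1 - x) := hr_eq ▸ abs_log_ratio_sub_one_le hx0 hx1 hβ₂0 hβ₂1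
  -- The first index whose normalised lattice coordinate is at least `u`.
  set k := ⌈(u + Real.log n) / r⌉₊ with hk_def
  have hk₁ : u + Real.log n ≤ k * r := (div_le_iff₀ hr).1 (Nat.le_ceil _)
  -- The assumption `-log n ≤ u` enters here: for a negative quotient the natural ceiling would be
  -- `0`, possibly more than one step too high.
  have hk₂ : k * r ≤ u + Real.log n + r := by
    have := (Nat.ceil_lt_add_one (div_nonneg (by linarith : 0 ≤ u + Real.log n) hr.le)).le
    have h2 := mul_le_mul_of_nonneg_right this hr.le
    rw [add_mul, div_mul_cancel₀ _ hr.ne', one_mul] at h2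
    exact h2
  have hpk : p₀₀ ^ k = Real.exp (-(k * r)) := by
    rw [← er, ← Real.exp_nat_mul, mul_neg]
  have hexp : Real.exp (-(u + Real.log n)) = Real.exp (-u) / n := by
    rw [neg_add, Real.exp_add, Real.exp_neg (Real.log n), Real.exp_log hn0, div_eq_mul_inv]
  have hpk_le : p₀₀ ^ k ≤ Real.exp (-u) / n := by
    rw [hpk, ← hexp]
    exact Real.exp_le_exp.2 (by linarith)
  have hpk_ge : p₀₀ * (Real.exp (-u) / n) ≤ p₀₀ ^ k := by
    rw [hpk, ← hexp, ← er, ← Real.exp_add]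
    exact Real.exp_le_exp.2 (by linarith)
  set lam := limitMeanMeasure γ δ u with hlam
  set b := Real.exp (-u) with hb_def
  have hb : 0 < b := Real.exp_pos _
  set ν : Measure (quadrant u) := ENNReal.ofReal (Real.exp u) • lam with hν
  have hbu : ENNReal.ofReal b * ENNReal.ofReal (Real.exp u) = 1 :=
    ofReal_exp_neg_mul_ofReal_exp u
  have hbν : ENNReal.ofReal b • ν = lam := by rw [hν, smul_smul, hbu, one_smul]
  have hνprob : IsProbabilityMeasure ν := ⟨by
    rw [hν, Measure.smul_apply, limitMeanMeasure_univ hγ hδ, smul_eq_mul, mul_comm, hbu]⟩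
  have hA := measurableSet_quadrant u
  let f : quadrant u → quadrant u := fun z ↦
    ⟨normalise n p₀₀ (latticePoint r κ₁ κ₂ u k z), latticePoint_normalise_mem hr hk₁ z⟩
  have hN : Measurable (normalise n p₀₀) := .of_discrete
  have hf : Measurable f := Measurable.subtype_mk
    ((hN.comp (measurable_latticePoint r κ₁ κ₂ u k)).comp measurable_subtype_coe)
  -- That the point probabilities sum to `1` need not be computed: the measure is the law of a
  -- random variable, and `1 ≤ n` provides one.
  have hgeo : IsProbabilityMeasure (geometricLaw q₁ q₂ p₀₀) := by
    have h := hX_law ⟨0, hn⟩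
    rw [← h.map_eq]
    exact Measure.isProbabilityMeasure_map h.aemeasurable
  set μ := (geometricLaw q₁ q₂ p₀₀).map (normalise n p₀₀) with hμ
  have hμprob : IsProbabilityMeasure μ := Measure.isProbabilityMeasure_map hN.aemeasurable
  have hμν : μ.comap Subtype.val = ENNReal.ofReal (p₀₀ ^ k) • ν.map f := by
    ext B hB
    have hB' : MeasurableSet (Subtype.val '' B : Set Plane) := hA.subtype_image hB
    set C : Set (ℕ × ℕ) := normalise n p₀₀ ⁻¹' (Subtype.val '' B) with hC
    -- Marks falling in the quadrant have both coordinates at least `k`, so the restriction in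
    -- `smul_map_latticePoint` loses nothing.
    have hCk : C ⊆ {x | k ≤ x.1 ∧ k ≤ x.2} := by
      rintro y ⟨z, -, hz⟩
      exact le_of_normalise_mem hr (hz ▸ z.2)
    have h1 : Subtype.val '' (f ⁻¹' B) = latticePoint r κ₁ κ₂ u k ⁻¹' C ∩ quadrant u := by
      ext z
      constructor
      · rintro ⟨z, hz, rfl⟩
        exact ⟨⟨f z, hz, rfl⟩, z.2⟩
      · rintro ⟨⟨w, hw, hwz⟩, hz⟩
        refine ⟨⟨z, hz⟩, ?_, rfl⟩
        have : f ⟨z, hz⟩ = w := Subtype.ext hwz.symm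
        rwa [Set.mem_preimage, this]
    have h2 := congrArg (fun ρ : Measure (ℕ × ℕ) ↦ ρ C)
      (smul_map_latticePoint hγ hδ hq₁ hq₂ hp₀₀ hr hκ₁ hκ₂ er e₁ e₂ u k)
    have hCm : MeasurableSet C := .of_discrete
    simp only [Measure.smul_apply, smul_eq_mul] at h2
    rw [Measure.map_apply (measurable_latticePoint _ _ _ _ _) hCm, Measure.restrict_apply
      (measurable_latticePoint _ _ _ _ _ hCm), Measure.restrict_apply hCm,
      Set.inter_eq_left.2 hCk, ← h1] at h2
    rw [comap_subtype_coe_apply hA, hμ, Measure.map_apply hN hB', Measure.smul_apply,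
      Measure.map_apply hf hB, hν, Measure.smul_apply, hlam, limitMeanMeasure,
      comap_subtype_coe_apply hA, smul_eq_mul, smul_eq_mul, mul_left_comm, h2, ← mul_assoc,
      mul_comm (ENNReal.ofReal (Real.exp u)), hbu, one_mul]
  have hlaw : P.map (exceedanceProcess n p₀₀ u X) =
      (Measure.pi fun _ : Fin n ↦ μ).map (configIn (quadrant u)) :=
    map_exceedanceProcess p₀₀ u hX_law hX_indep
  have hDν := integral_abs_sub_limitMeanMeasure hγ hδ u
  have hW : ∫ z, d0 (f z) z ∂ν ≤ 3 * r + x / (1 - x) * (γ / (1 + δ) + δ / (1 + γ)) := by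
    calc ∫ z, d0 (f z) z ∂ν
        ≤ ∫ z : quadrant u, (3 * r + x / (1 - x) * |z.1 0 - z.1 1|) ∂ν := by
          refine integral_mono_of_nonneg (Filter.Eventually.of_forall fun z ↦ d0_nonneg _ _)
            ((integrable_const _).add (hDν.1.const_mul _)) (Filter.Eventually.of_forall fun z ↦ ?_)
          exact (min_le_left _ _).trans
            (dist_normalise_latticePoint_le hr hκ₁ hκ₂ hε₁ hε₂ hk₁ hk₂ z.2)
      _ = _ := by
          rw [integral_add (integrable_const _) (hDν.1.const_mul _), integral_const, integral_const_mul,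
            hDν.2]
          simp
  have hnp : n * p₀₀ ^ k ≤ b := by
    have := mul_le_mul_of_nonneg_left hpk_le hn0.le
    rwa [mul_div_cancel₀ _ hn0.ne'] at this
  have hnp' : p₀₀ * b ≤ n * p₀₀ ^ k := by
    have := mul_le_mul_of_nonneg_left hpk_ge hn0.le
    rwa [mul_left_comm, mul_div_cancel₀ _ hn0.ne'] at this
  have main := d2_map_configIn_PRM_le hA μ ν hf (pow_pos hp₀₀_pos k)
    (pow_le_one₀ hp₀₀_pos.le (by linarith)) hμν hn hnp
  rw [hbν, ← hlaw] at main
  refine main.trans (sum_bounds_le hγ hδ hp0 hx1 hb_def hp₀₀ hpk_le hnp'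
    (integral_nonneg fun z ↦ d0_nonneg _ _) ?_)
  -- With `r ≤ x / (1 - x)` and a mean excess of at most `γ + δ`, the displacement is at most `4 (1
  -- + γ + δ) x / (1 - x)`.
  have g1 : γ / (1 + δ) ≤ γ := div_le_self hγ.le (by linarith)
  have g2 : δ / (1 + γ) ≤ δ := div_le_self hδ.le (by linarith)
  have g3 : x / (1 - x) * (γ / (1 + δ) + δ / (1 + γ)) ≤ x / (1 - x) * (1 + γ + δ) :=
    mul_le_mul_of_nonneg_left (by linarith) (hr.le.trans hr2)
  have g4 : x / (1 - x) * 1 ≤ x / (1 - x) * (1 + γ + δ) :=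
    mul_le_mul_of_nonneg_left (by linarith) (hr.le.trans hr2)
  linarith
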